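/- Let $n\ge 1$. A polytope in $\mathbb{R}^n$ is the convex hull of finitely many points; for an $n$-dimensional polytope $\Delta\subset\mathbb{R}^n$ let $\Delta[i]$ be the set of its $i$-dimensional faces, so that $\Delta[0]$ is the set of its vertices and $\Delta[1]$ the set of its edges. A vector $w\in\mathbb{Z}^n$ is primitive if $w=m\widetilde w$ with $m\in\mathbb{Z}$ and $\widetilde w\in\mathbb{Z}^n$ implies $m=\pm1$. An $n$-dimensional polytope $\Delta\subset\mathbb{R}^n$ is called Delzant if, at each vertex $v$, exactly $n$ edges of $\Delta$ meet, and these edges lie on half-lines $\{v+tw_i \mid t\ge 0\}$, $i=1,\dots,n$, where $w_1,\dots,w_n\in\mathbb{Z}^n$ can be chosen to be a basis of $\mathbb{Z}^n$. It is called reflexive if all its vertices lie in $\mathbb{Z}^n$, $\mathbf 0$ lies in its interior, and $$\Delta=\bigcap_{i=1}^k\{x\in\mathbb{R}^n \mid \langle x,l_i\rangle\le 1\},$$ where $l_1,\dots,l_k\in\mathbb{Z}^n$ are the primitive outward normal vectors to the facets (the $(n-1)$-dimensional faces) of $\Delta$. The relative length $l(e)$ of an edge $e$ with endpoints $v_1,v_2$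 is the unique real number $l(e)>0$ such that $v_2-v_1=l(e)\,w$ for some primitive $w\in\mathbb{Z}^n$; it exists for every edge of a polytope whose vertices are all in $\mathbb{Z}^n$. (i) If $\Delta\subset\mathbb{R}^2$ is a $2$-dimensional Delzant reflexive polytope, then $$\sum_{e\in\Delta[1]} l(e)+|\Delta[0]|=12.$$ (ii) If $\Delta\subset\mathbb{R}^3$ is a $3$-dimensional Delzant reflexive polytope, then $$\sum_{e\in\Delta[1]} l(e)=24.$$ -/

import Mathlib

open scoped InnerProductSpace

namespace LatticePolytope

/-- The integral vector `w ∈ ℤⁿ`, regarded as a vector of Euclidean space `ℝⁿ`. -/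
noncomputable def intVec {n : ℕ} (w : Fin n → ℤ) : EuclideanSpace ℝ (Fin n) :=
  WithLp.toLp 2 (fun i => (w i : ℝ))

/-- `w ∈ ℤⁿ` is primitive: `w = m • w'` with `m ∈ ℤ`, `w' ∈ ℤⁿ` forces `m = ±1`. -/
def IsPrimitiveVec {n : ℕ} (w : Fin n → ℤ) : Prop :=
  ∀ (m : ℤ) (w' : Fin n → ℤ), w = m • w' → m = 1 ∨ m = -1

/-- A polytope is the convex hull of finitely many points. -/
def IsPolytope {n : ℕ} (Δ : Set (EuclideanSpace ℝ (Fin n))) : Prop :=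
  ∃ S : Set (EuclideanSpace ℝ (Fin n)), S.Finite ∧ Δ = convexHull ℝ S

/-- The dimension of a (nonempty) convex set: the dimension of its affine span. -/
noncomputable def affDim {n : ℕ} (F : Set (EuclideanSpace ℝ (Fin n))) : ℕ :=
  Module.finrank ℝ (vectorSpan ℝ F)

/-- The set `Δ[k]` of the `k`-dimensional faces of `Δ`. A face is a nonempty set of the form
`{x ∈ Δ | φ x = max φ on Δ}` for a linear functional `φ` (`φ = 0` gives `Δ` itself). -/
def faces {n : ℕ} (Δ : Set (EuclideanSpace ℝ (Fin n))) (k : ℕ) :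
    Set (Set (EuclideanSpace ℝ (Fin n))) :=
  {F | F.Nonempty ∧ IsExposed ℝ Δ F ∧ affDim F = k}

/-- `v` is a vertex of `Δ`: the singleton `{v}` is a `0`-dimensional face. -/
def IsVertex {n : ℕ} (Δ : Set (EuclideanSpace ℝ (Fin n))) (v : EuclideanSpace ℝ (Fin n)) : Prop :=
  {v} ∈ faces Δ 0

/-- The set of the edges of `Δ` that meet at the point `v`. -/
def edgesAt {n : ℕ} (Δ : Set (EuclideanSpace ℝ (Fin n))) (v : EuclideanSpace ℝ (Fin n)) :
    Set (Set (EuclideanSpace ℝ (Fin n))) :=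
  {e | e ∈ faces Δ 1 ∧ v ∈ e}

/-- The half-line `{v + t w | t ≥ 0}`, for `w ∈ ℤⁿ`. -/
def ray {n : ℕ} (v : EuclideanSpace ℝ (Fin n)) (w : Fin n → ℤ) :
    Set (EuclideanSpace ℝ (Fin n)) :=
  {x | ∃ t : ℝ, 0 ≤ t ∧ x = v + t • intVec w}

/-- `Δ` is an `n`-dimensional Delzant polytope in `ℝⁿ`. -/
structure IsDelzant {n : ℕ} (Δ : Set (EuclideanSpace ℝ (Fin n))) : Prop where
  isPolytope : IsPolytope Δ
  fullDim : affDim Δ = n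
  /-- exactly `n` edges meet at each vertex -/
  simple : ∀ v, IsVertex Δ v → (edgesAt Δ v).Finite ∧ (edgesAt Δ v).ncard = n
  /-- the edges at each vertex have integral directions -/
  rational : ∀ v, IsVertex Δ v → ∀ e ∈ edgesAt Δ v, ∃ w : Fin n → ℤ, e ⊆ ray v w
  /-- integral directions of the edges at each vertex can be chosen to be a basis of `ℤⁿ` -/
  smooth : ∀ v, IsVertex Δ v → ∃ w : edgesAt Δ v → (Fin n → ℤ),
    (∀ e : edgesAt Δ v, (e : Set (EuclideanSpace ℝ (Fin n))) ⊆ ray v (w e)) ∧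
    LinearIndependent ℤ w ∧ Submodule.span ℤ (Set.range w) = ⊤

/-- `Δ` is integral: all its vertices belong to `ℤⁿ`. -/
def IsIntegral {n : ℕ} (Δ : Set (EuclideanSpace ℝ (Fin n))) : Prop :=
  ∀ v, IsVertex Δ v → ∃ z : Fin n → ℤ, v = intVec z

/-- The set of the primitive outward normal vectors `l ∈ ℤⁿ` of the facets of `Δ ⊆ ℝⁿ`:
`⟪x, l⟫ ≤ m` holds on `Δ` and the points of `Δ` with `⟪x, l⟫ = m` form a facet, that is, a face of
dimension `n - 1`. -/
def facetNormals {n : ℕ} (Δ : Set (EuclideanSpace ℝ (Fin n))) : Set (Fin n → ℤ) :=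
  {l | IsPrimitiveVec l ∧ ∃ m : ℝ, (∀ x ∈ Δ, ⟪x, intVec l⟫_ℝ ≤ m) ∧
    ∃ F ∈ faces Δ (n - 1), F = {x ∈ Δ | ⟪x, intVec l⟫_ℝ = m}}

/-- `Δ` is an `n`-dimensional reflexive polytope in `ℝⁿ`. -/
structure IsReflexive {n : ℕ} (Δ : Set (EuclideanSpace ℝ (Fin n))) : Prop where
  isPolytope : IsPolytope Δ
  fullDim : affDim Δ = n
  isIntegral : IsIntegral Δ
  zero_mem_interior : (0 : EuclideanSpace ℝ (Fin n)) ∈ interior Δ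
  eq_iInter : Δ = ⋂ l ∈ facetNormals Δ, {x | ⟪x, intVec l⟫_ℝ ≤ 1}

/-- `e` is a segment from `v₁` to `v₂` and `v₂ - v₁ = r w` with `w ∈ ℤⁿ` primitive and `r > 0`. -/
def HasRelativeLength {n : ℕ} (e : Set (EuclideanSpace ℝ (Fin n))) (r : ℝ) : Prop :=
  ∃ (v₁ v₂ : EuclideanSpace ℝ (Fin n)) (w : Fin n → ℤ),
    e = segment ℝ v₁ v₂ ∧ IsPrimitiveVec w ∧ 0 < r ∧ v₂ - v₁ = r • intVec w

/-- An integer dividing all the coordinates of a primitive vector is `±1`. -/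
theorem IsPrimitiveVec.eq_one_of_dvd {n : ℕ} {w : Fin n → ℤ} (hw : IsPrimitiveVec w) {a : ℤ}
    (ha : 0 ≤ a) (h : ∀ i, a ∣ w i) : a = 1 := by
  choose u hu using h
  have := hw a u (by ext i; simp [hu i])
  omega

theorem IsPrimitiveVec.eq_of_abs {n : ℕ} {w w' : Fin n → ℤ} (hw : IsPrimitiveVec w)
    (hw' : IsPrimitiveVec w') {r r' : ℝ} (hr : 0 < r) (hr' : 0 < r')
    (h : ∀ i, r * |(w i : ℝ)| = r' * |(w' i : ℝ)|) : r = r' := by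
  obtain ⟨i, hi⟩ : ∃ i, w i ≠ 0 := by
    by_contra! hcon
    have := hw 0 0 (by ext j; simp [hcon j])
    omega
  have hA : 0 < |(w i : ℝ)| := abs_pos.mpr (by exact_mod_cast hi)
  have hcross : ∀ j, |w i| * |w' j| = |w' i| * |w j| := by
    intro j
    have h1 : (r * r') * (|(w i : ℝ)| * |(w' j : ℝ)|) = (r * r') * (|(w' i : ℝ)| * |(w j : ℝ)|) := by
      linear_combination (r' * |(w' j : ℝ)|) * h i - (r' * |(w' i : ℝ)|) * h j
    have h2 := mul_left_cancel₀ (mul_pos hr hr').ne' h1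
    exact_mod_cast h2
  have hB : 0 < |(w' i : ℝ)| := by
    have := h i
    have h3 : 0 < r' * |(w' i : ℝ)| := this ▸ mul_pos hr hA
    exact pos_of_mul_pos_right h3 hr'.le
  have hAz : 0 < |w i| := by exact_mod_cast hA
  have hBz : 0 < |w' i| := by exact_mod_cast hB
  obtain ⟨g, a, b, hg, hab, ha, hb⟩ : ∃ g a b : ℤ, 0 < g ∧ IsCoprime a b ∧
      |w i| = a * g ∧ |w' i| = b * g := by
    obtain ⟨g, a, b, hg, hab, ha, hb⟩ := Int.exists_gcd_one' (m := |w i|) (n := |w' i|)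
      (Int.gcd_pos_of_ne_zero_left _ hAz.ne')
    exact ⟨g, a, b, by exact_mod_cast hg, Int.isCoprime_iff_gcd_eq_one.mpr hab, ha, hb⟩
  have ha0 : 0 < a := pos_of_mul_pos_left (ha ▸ hAz) hg.le
  have hb0 : 0 < b := pos_of_mul_pos_left (hb ▸ hBz) hg.le
  have hc : ∀ j, a * |w' j| = b * |w j| := by
    intro j
    have := hcross j
    rw [ha, hb] at this
    exact mul_left_cancel₀ hg.ne' (by linear_combination this)
  have ha1 : a = 1 := hw.eq_one_of_dvd ha0.le fun j =>
    (dvd_abs _ _).mp (hab.dvd_of_dvd_mul_left ⟨_, (hc j).symm⟩)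
  have hb1 : b = 1 := hw'.eq_one_of_dvd hb0.le fun j =>
    (dvd_abs _ _).mp (hab.symm.dvd_of_dvd_mul_left ⟨_, hc j⟩)
  have hEq : |(w i : ℝ)| = |(w' i : ℝ)| := by
    have : |w i| = |w' i| := by rw [ha, hb, ha1, hb1]
    exact_mod_cast this
  have := h i
  rw [← hEq] at this
  exact mul_right_cancel₀ hA.ne' this

theorem abs_sub_le_of_segment_subset {n : ℕ} {a b c d : EuclideanSpace ℝ (Fin n)}
    (h : segment ℝ c d ⊆ segment ℝ a b) (i : Fin n) : |d i - c i| ≤ |b i - a i| := by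
  have key : ∀ x ∈ segment ℝ a b, x i ∈ Set.uIcc (a i) (b i) := by
    intro x hx
    rw [← segment_eq_uIcc]
    obtain ⟨s, t, hs, ht, hst, rfl⟩ := hx
    exact ⟨s, t, hs, ht, hst, by simp⟩
  exact Set.abs_sub_le_of_uIcc_subset_uIcc (Set.uIcc_subset_uIcc
    (key _ (h (left_mem_segment ℝ c d))) (key _ (h (right_mem_segment ℝ c d))))

/-- The relative length of a segment is unique. -/
theorem HasRelativeLength.unique {n : ℕ} {e : Set (EuclideanSpace ℝ (Fin n))} {r r' : ℝ}
    (h : HasRelativeLength e r) (h' : HasRelativeLength e r') : r = r' := by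
  obtain ⟨a, b, w, he, hw, hr, hab⟩ := h
  obtain ⟨c, d, w', he', hw', hr', hcd⟩ := h'
  have hseg := he.symm.trans he'
  refine hw.eq_of_abs hw' hr hr' fun i => ?_
  have h1 : b i - a i = r * (w i : ℝ) := by
    simpa [intVec] using congrArg (fun x : EuclideanSpace ℝ (Fin n) => x i) hab
  have h2 : d i - c i = r' * (w' i : ℝ) := by
    simpa [intVec] using congrArg (fun x : EuclideanSpace ℝ (Fin n) => x i) hcd
  have h3 : |b i - a i| = |d i - c i| :=
    le_antisymm (abs_sub_le_of_segment_subset hseg.le i)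
      (abs_sub_le_of_segment_subset hseg.ge i)
  rw [h1, h2, abs_mul, abs_mul, abs_of_pos hr, abs_of_pos hr'] at h3
  exact h3

open Classical in
/-- The relative length `l(e)` of a segment `e` (with value `0` if `e` has none). -/
noncomputable def relativeLength {n : ℕ} (e : Set (EuclideanSpace ℝ (Fin n))) : ℝ :=
  if h : ∃ r, HasRelativeLength e r then h.choose else 0

theorem HasRelativeLength.relativeLength_eq {n : ℕ} {e : Set (EuclideanSpace ℝ (Fin n))} {r : ℝ}
    (h : HasRelativeLength e r) : relativeLength e = r := by
  have h' : ∃ r, HasRelativeLength e r := ⟨r, h⟩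
  rw [relativeLength, dif_pos h']
  exact h'.choose_spec.unique h

end LatticePolytope

/-! The proof is the localization formula for the Todd genus of the toric variety of the polytope,
carried out with lattice cones. Let `w p i` be the edge directions at the vertex `p` and `l p i` the
dual outward normals. Reflexivity puts every facet at height 1, so the vertex itself is `-∑ i, w p
i`.

For a generic additive `ξ` one has `∑ p, ∏ i, (1 - exp (-ξ (w p i)))⁻¹ = 1`
(`sum_prod_inv_one_sub_exp`). Each factor is expanded as a geometric series in its direction of
convergence, so that the left side becomes a signed sum of half-open cones over the lattice; by
`sum_cones` only the origin survives.

Replacing `ξ` by `t • ξ` and comparing constant terms as `t → 0`, with `1 / (1 - exp (-u)) = 1 / u +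
1 / 2 + u / 12 + o(u)`, evaluates the sum of the ratios `ξ (w p j) / ξ (w p i)` (`sum_ratio_two`,
`sum_ratio_three`).

That sum is the total edge length. If the edge `w p i` runs from `p` to `q` and has length `T`, then
`T * ξ (w p i) = ξ q - ξ p = ∑ j, ξ (w p j) - ∑ j, ξ (w q j)`. As the direction at `q` is `-w p i`,
dividing by `ξ (w p i)` splits `T` into one sum of ratios for each end (`sum_relativeLength`). The
link with convex geometry is `exists_localModel`: the facets through a vertex are exactly those dual
to its edges. -/

/-! ### Alternating sums and geometric series. -/

/-- The alternating sum over an interval of the Boolean lattice, cut out by a set `U`. -/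
theorem Finset.sum_powerset_interval_neg_one_pow {α : Type*} [DecidableEq α]
    (N B U : Finset α) (hNB : N ⊆ B) :
    (∑ S ∈ U.powerset, if N ⊆ S ∧ S ⊆ B then (-1 : ℝ) ^ S.card else 0) =
      if N = B ∩ U then (-1) ^ N.card else 0 := by
  by_cases hNU : N ⊆ U
  · rw [← Finset.sum_filter]
    -- The interval from `N` to `B ∩ U` is the Boolean lattice of `(B ∩ U) \ N`, whose alternating
    -- sum vanishes unless that set is empty.
    have hbij : ∑ S ∈ U.powerset with N ⊆ S ∧ S ⊆ B, (-1 : ℝ) ^ S.card =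
        ∑ S ∈ ((B ∩ U) \ N).powerset, (-1) ^ N.card * (-1 : ℝ) ^ S.card := by
      refine Finset.sum_bij' (fun S _ => S \ N) (fun S _ => N ∪ S) ?_ ?_ ?_ ?_ ?_
      · intro S hS
        simp only [Finset.mem_filter, Finset.mem_powerset] at hS ⊢
        exact Finset.sdiff_subset_sdiff (Finset.subset_inter hS.2.2 hS.1) le_rfl
      · intro S hS
        simp only [Finset.mem_filter, Finset.mem_powerset] at hS ⊢
        have h := hS.trans Finset.sdiff_subset
        exact ⟨Finset.union_subset hNU (h.trans Finset.inter_subset_right),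
          Finset.subset_union_left,
          Finset.union_subset hNB (h.trans Finset.inter_subset_left)⟩
      · intro S hS
        simp only [Finset.mem_filter] at hS
        exact Finset.union_sdiff_of_subset hS.2.1
      · intro S hS
        simp only [Finset.mem_powerset] at hS
        exact Finset.union_sdiff_cancel_left
          (Finset.disjoint_of_subset_right hS Finset.disjoint_sdiff)
      · intro S hS
        simp only [Finset.mem_filter] at hS
        rw [← pow_add, ← Finset.card_sdiff_add_card_eq_card hS.2.1, add_comm]
    rw [hbij, ← Finset.mul_sum]
    have h0 : ∑ S ∈ ((B ∩ U) \ N).powerset, (-1 : ℝ) ^ S.card =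
        if (B ∩ U) \ N = ∅ then 1 else 0 := by
      exact_mod_cast congrArg (Int.cast : ℤ → ℝ)
        (Finset.sum_powerset_neg_one_pow_card (x := (B ∩ U) \ N))
    rw [h0]
    have hiff : (B ∩ U) \ N = ∅ ↔ N = B ∩ U := by
      rw [Finset.sdiff_eq_empty_iff_subset]
      exact ⟨(Finset.subset_inter hNB hNU).antisymm, fun h => h.ge⟩
    simp [hiff]
  · rw [if_neg fun h : N = B ∩ U => hNU (h.le.trans Finset.inter_subset_right)]
    refine Finset.sum_eq_zero fun S hS => if_neg fun h => hNU (h.1.trans ?_)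
    exact Finset.mem_powerset.mp hS

/-- The geometric series of `1 / (1 - exp (-a))`, expanded in the direction in which it
converges, as a family indexed by `ℤ`. -/
noncomputable def geomTerm (a : ℝ) (c : ℤ) : ℝ :=
  if (0 ≤ c ↔ 0 < a) then (if 0 < a then 1 else -1) * Real.exp (-(c * a)) else 0

theorem hasSum_geomTerm {a : ℝ} (ha : a ≠ 0) :
    HasSum (geomTerm a) (1 - Real.exp (-a))⁻¹ := by
  rcases ha.lt_or_gt with h | h
  -- For `a < 0` the value is `-exp a / (1 - exp a)`, a series over the strictly negative indices `c
  -- = -k - 1`.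
  · have hlt : Real.exp a < 1 := Real.exp_lt_one_iff.mpr h
    have hg := (hasSum_geometric_of_lt_one (Real.exp_pos a).le hlt).mul_left (-Real.exp a)
    have hinj : Function.Injective (fun k : ℕ => (-(k : ℤ) - 1)) := fun a b h => by
      simp only at h; omega
    have hval : -Real.exp a * (1 - Real.exp a)⁻¹ = (1 - Real.exp (-a))⁻¹ := by
      have h1 : 1 - Real.exp a ≠ 0 := by linarith
      have h2 : (1 - Real.exp (-a)) ≠ 0 := by
        have := Real.one_lt_exp_iff.mpr (neg_pos.mpr h)
        linarith
      have h3 : Real.exp a * Real.exp (-a) = 1 := by rw [← Real.exp_add]; simp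
      field_simp
      linear_combination h3
    rw [← hval, ← hinj.hasSum_iff]
    · refine (funext fun k => ?_ : geomTerm a ∘ (fun k : ℕ => (-(k : ℤ) - 1)) = _) ▸ hg
      have : ¬ (0 : ℤ) ≤ -(k : ℤ) - 1 := by omega
      simp only [Function.comp, geomTerm, this, h.le.not_gt, if_true, if_false]
      rw [← Real.exp_nat_mul, neg_one_mul, neg_mul, ← Real.exp_add]
      congr 2
      push_cast
      ring
    · intro c hc
      have : 0 ≤ c := by
        by_contra hcon
        exact hc ⟨(-c - 1).toNat, by simp only; omega⟩
      simp [geomTerm, this, h.le.not_gt]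
  · have hlt : Real.exp (-a) < 1 := Real.exp_lt_one_iff.mpr (by linarith)
    have hg := hasSum_geometric_of_lt_one (Real.exp_pos (-a)).le hlt
    have hinj : Function.Injective (fun k : ℕ => (k : ℤ)) := Nat.cast_injective
    rw [← hinj.hasSum_iff]
    · refine (funext fun k => ?_ : geomTerm a ∘ (fun k : ℕ => (k : ℤ)) = _) ▸ hg
      simp only [Function.comp, geomTerm, h, Int.natCast_nonneg, if_true, one_mul]
      rw [← Real.exp_nat_mul]
      congr 1
      push_cast
      ring
    · intro c hc
      have : ¬ 0 ≤ c := fun hcon => hc ⟨c.toNat, by simp only; omega⟩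
      simp [geomTerm, this, h]

/-- A finite product of sums of real series is the sum over the tuples of indices. -/
theorem hasSum_prod_pi {κ : Type*} {n : ℕ} {f : Fin n → κ → ℝ} {s : Fin n → ℝ}
    (h : ∀ i, HasSum (f i) (s i)) :
    HasSum (fun c : Fin n → κ => ∏ i, f i (c i)) (∏ i, s i) := by
  induction n with
  | zero => simp
  | succ n ih =>
    have key : ∀ F : (Fin n → κ) → ℝ, ∀ S : ℝ, HasSum F S →
        HasSum (fun x : κ × (Fin n → κ) => f 0 x.1 * F x.2) (s 0 * S) := fun F S hF =>
      (h 0).mul hF (summable_mul_of_summable_norm (h 0).summable.norm hF.summable.norm)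
    have h3 := key _ _ (ih fun i => h i.succ)
    let e : κ × (Fin n → κ) ≃ (Fin (n + 1) → κ) := Fin.consEquiv fun _ => κ
    rw [← e.hasSum_iff, Fin.prod_univ_succ]
    have he : (fun c : Fin (n + 1) → κ => ∏ i, f i (c i)) ∘ e =
        fun x : κ × (Fin n → κ) => f 0 x.1 * ∏ i, f i.succ (x.2 i) := by
      funext x
      simp [e, Fin.prod_univ_succ, Fin.consEquiv]
    rw [he]
    exact h3

/-! ### Combinatorics of vertices, facets and descents. -/

namespace LatticePolytope

open Matrix Finset

/-- The combinatorial data of a smooth reflexive polytope: at each vertex `p` (an element of `ι`)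
the edge directions `w p i` and the dual outward facet normals `l p i`. The position of the vertex
`p` is `-∑ i, w p i`. -/
structure IsSmoothReflexive {ι : Type*} {n : ℕ} (w l : ι → Fin n → (Fin n → ℤ)) : Prop where
  dual : ∀ p i j, w p i ⬝ᵥ l p j = if i = j then -1 else 0
  le_one : ∀ p q i, (-∑ j, w q j) ⬝ᵥ l p i ≤ 1
  mem_of_eq : ∀ p q i, (-∑ j, w q j) ⬝ᵥ l p i = 1 → ∃ j, l q j = l p i
  inj : Function.Injective fun p => -∑ j, w p j
  adj : ∀ p i, ∃ q, ∃ t : ℤ, 0 < t ∧ -∑ j, w q j = -∑ j, w p j + t • w p i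

variable {ι : Type*} {n : ℕ} {w l : ι → Fin n → (Fin n → ℤ)}

/-- The normals of the facets through the vertex `p`. -/
def normalsAt (l : ι → Fin n → (Fin n → ℤ)) (p : ι) : Finset (Fin n → ℤ) :=
  univ.image (l p)

/-- The normals of the facets through `p` that are opposite to the edges along which `ξ`
decreases. -/
noncomputable def descents (w l : ι → Fin n → (Fin n → ℤ)) (ξ : (Fin n → ℤ) →+ ℝ) (p : ι) :
    Finset (Fin n → ℤ) :=
  {i | ξ (w p i) < 0}.toFinset.image (l p)

namespace IsSmoothReflexive

theorem normal_injective (h : IsSmoothReflexive w l) (p : ι) : Function.Injective (l p) := by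
  intro i j hij
  by_contra hne
  have h1 := h.dual p i i
  have h2 := h.dual p i j
  rw [if_pos rfl, hij] at h1
  rw [if_neg hne] at h2
  omega

/-- Duality makes the matrix of the `w p i` and minus the transpose of that of the `l p i` inverse
to each other, on both sides because they are square. Hence `-(x ⬝ᵥ l p i)` are the coordinates of
`x` in the basis `w p`. -/
theorem eq_sum (h : IsSmoothReflexive w l) (p : ι) (x : Fin n → ℤ) :
    x = ∑ i, (-(x ⬝ᵥ l p i)) • w p i := by
  have h1 : (Matrix.of (w p)) * (-(Matrix.of (l p))ᵀ) = 1 := by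
    ext i j
    have : (Matrix.of (w p) * (Matrix.of (l p))ᵀ) i j = w p i ⬝ᵥ l p j := rfl
    rw [Matrix.mul_neg, Matrix.neg_apply, this, h.dual, Matrix.one_apply]
    split_ifs <;> simp
  have h2 := mul_eq_one_comm.mp h1
  have h3 : x = x ᵥ* (-(Matrix.of (l p))ᵀ * Matrix.of (w p)) := by rw [h2, vecMul_one]
  rw [← vecMul_vecMul] at h3
  conv_lhs => rw [h3]
  ext k
  simp only [vecMul, dotProduct, Finset.sum_apply, Pi.smul_apply, smul_eq_mul, Matrix.of_apply,
    Matrix.neg_apply, Matrix.transpose_apply, mul_neg, Finset.sum_neg_distrib]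

theorem map_eq_sum (h : IsSmoothReflexive w l) (p : ι) (ξ : (Fin n → ℤ) →+ ℝ) (x : Fin n → ℤ) :
    ξ x = ∑ i, ((-(x ⬝ᵥ l p i) : ℤ) : ℝ) * ξ (w p i) := by
  conv_lhs => rw [h.eq_sum p x]
  rw [map_sum]
  exact Finset.sum_congr rfl fun i _ => by rw [map_zsmul, zsmul_eq_mul]

theorem position_dot (h : IsSmoothReflexive w l) (p : ι) (i : Fin n) :
    (-∑ j, w p j) ⬝ᵥ l p i = 1 := by
  rw [neg_dotProduct, sum_dotProduct]
  simp [h.dual]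

theorem mem_normalsAt_iff (h : IsSmoothReflexive w l) (p q : ι) (i : Fin n) :
    l p i ∈ normalsAt l q ↔ (-∑ j, w q j) ⬝ᵥ l p i = 1 := by
  constructor
  · intro hm
    obtain ⟨j, -, hj⟩ := Finset.mem_image.mp hm
    rw [← hj, h.position_dot]
  · intro hm
    obtain ⟨j, hj⟩ := h.mem_of_eq p q i hm
    exact Finset.mem_image.mpr ⟨j, mem_univ _, hj⟩

theorem descents_subset (p : ι) (ξ : (Fin n → ℤ) →+ ℝ) : descents w l ξ p ⊆ normalsAt l p :=
  Finset.image_subset_image (subset_univ _)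

theorem mem_descents_iff (h : IsSmoothReflexive w l) (p : ι) (ξ : (Fin n → ℤ) →+ ℝ) (i : Fin n) :
    l p i ∈ descents w l ξ p ↔ ξ (w p i) < 0 := by
  rw [descents, (h.normal_injective p).mem_finset_image]
  simp

theorem card_descents (h : IsSmoothReflexive w l) (p : ι) (ξ : (Fin n → ℤ) →+ ℝ) :
    (descents w l ξ p).card = (univ.filter fun i => ξ (w p i) < 0).card := by
  rw [descents, Finset.card_image_of_injective _ (h.normal_injective p)]
  congr 1
  ext i
  simp

/-- Every vertex of the face `S` at which `ξ` decreases along no edge of the face minimizes `ξ`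
over the face. -/
theorem map_sub_nonneg (h : IsSmoothReflexive w l) {ξ : (Fin n → ℤ) →+ ℝ}
    {p q : ι} {S : Finset (Fin n → ℤ)} (hp : descents w l ξ p ⊆ S)
    (hSq : S ⊆ normalsAt l q) :
    ∀ i, 0 ≤ ((-((-∑ j, w q j - -∑ j, w p j) ⬝ᵥ l p i) : ℤ) : ℝ) * ξ (w p i) := by
  intro i
  -- A facet in `S` contains both vertices, so this coordinate of `q - p` is zero. For a facet
  -- outside `S`, the coordinate is nonnegative by `le_one` and `ξ` does not decrease along the
  -- edge.
  by_cases hi : l p i ∈ S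
  · have h1 := (h.mem_normalsAt_iff p q i).mp (hSq hi)
    rw [sub_dotProduct, h1, h.position_dot]
    simp
  · have h1 : 0 ≤ ξ (w p i) := by
      by_contra hcon
      exact hi (hp ((h.mem_descents_iff p ξ i).mpr (not_le.mp hcon)))
    refine mul_nonneg ?_ h1
    have := h.le_one p q i
    rw [sub_dotProduct, h.position_dot]
    exact_mod_cast (by omega)

/-- A generic functional has exactly one vertex on each nonempty face at which it does not
decrease along the edges of the face. -/
theorem unique_minimum (h : IsSmoothReflexive w l) {ξ : (Fin n → ℤ) →+ ℝ}
    (hξ : ∀ p i, ξ (w p i) ≠ 0) {S : Finset (Fin n → ℤ)} {p q : ι}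
    (hp : descents w l ξ p ⊆ S ∧ S ⊆ normalsAt l p)
    (hq : descents w l ξ q ⊆ S ∧ S ⊆ normalsAt l q) : q = p := by
  have h1 := h.map_sub_nonneg hp.1 hq.2
  have h2 := h.map_sub_nonneg hq.1 hp.2
  have e1 := h.map_eq_sum p ξ (-∑ j, w q j - -∑ j, w p j)
  have e2 := h.map_eq_sum q ξ (-∑ j, w p j - -∑ j, w q j)
  have e3 : ξ (-∑ j, w p j - -∑ j, w q j) = -ξ (-∑ j, w q j - -∑ j, w p j) := by
    rw [← map_neg, neg_sub]
  have p1 := Finset.sum_nonneg fun i (_ : i ∈ univ) => h1 i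
  have p2 := Finset.sum_nonneg fun i (_ : i ∈ univ) => h2 i
  rw [← e1] at p1
  rw [← e2, e3] at p2
  -- Both vertices minimize `ξ` on the face, so `ξ` agrees on them. Every nonnegative term of the
  -- expansion then vanishes, and genericity kills each coordinate of `q - p`.
  have h0 : ξ (-∑ j, w q j - -∑ j, w p j) = 0 := by linarith
  rw [h0] at e1
  have h4 := (Finset.sum_eq_zero_iff_of_nonneg fun i _ => h1 i).mp e1.symm
  have h5 := h.eq_sum p (-∑ j, w q j - -∑ j, w p j)
  refine h.inj (sub_eq_zero.mp (h5.trans (Finset.sum_eq_zero fun i hi => ?_)))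
  have h6 := (mul_eq_zero.mp (h4 i hi)).resolve_right (hξ p i)
  rw [Int.cast_eq_zero.mp h6, zero_smul]

/-- Take a vertex of the face `S` where `ξ` is least. A descending edge opposite to a facet outside
`S` would stay on all facets of `S` and lead to a vertex of the face with a smaller value. -/
theorem exists_minimum [Finite ι] (h : IsSmoothReflexive w l) (ξ : (Fin n → ℤ) →+ ℝ)
    {S : Finset (Fin n → ℤ)} (hS : ∃ p, S ⊆ normalsAt l p) :
    ∃ p, descents w l ξ p ⊆ S ∧ S ⊆ normalsAt l p := by
  obtain ⟨p, hp, hmin⟩ := Set.exists_min_image {p | S ⊆ normalsAt l p}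
    (fun p => ξ (-∑ j, w p j)) (Set.toFinite _) hS
  refine ⟨p, fun a ha => ?_, hp⟩
  obtain ⟨i, -, rfl⟩ := Finset.mem_image.mp (descents_subset p ξ ha)
  by_contra hi
  obtain ⟨q, t, ht, hq⟩ := h.adj p i
  have hqS : S ⊆ normalsAt l q := by
    intro s hs
    obtain ⟨j, -, rfl⟩ := Finset.mem_image.mp (hp hs)
    have hij : i ≠ j := fun hij => hi (hij ▸ hs)
    rw [h.mem_normalsAt_iff, hq, add_dotProduct, h.position_dot, smul_dotProduct, h.dual,
      if_neg hij]
    simp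
  have h1 := hmin q hqS
  beta_reduce at h1
  rw [hq, map_add, map_zsmul, zsmul_eq_mul] at h1
  have h2 := mul_neg_of_pos_of_neg (Int.cast_pos (R := ℝ).mpr ht)
    ((h.mem_descents_iff p ξ i).mp ha)
  linarith

/-- The sum over the vertices with a prescribed pattern of descents does not depend on the generic
functional: it is the Euler characteristic of a nerve of facets. -/
theorem sum_descents_eq [Fintype ι] (h : IsSmoothReflexive w l) {ξ : (Fin n → ℤ) →+ ℝ}
    (hξ : ∀ p i, ξ (w p i) ≠ 0) (U : Finset (Fin n → ℤ)) [DecidablePred fun S => ∃ p, S ⊆ normalsAt l p] :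
    (∑ p, if descents w l ξ p = normalsAt l p ∩ U then
        (-1 : ℝ) ^ (descents w l ξ p).card else 0) =
      ∑ S ∈ U.powerset, if ∃ p, S ⊆ normalsAt l p then (-1 : ℝ) ^ S.card else 0 := by
  -- Each term is opened into a sum over the `S ⊆ U` between `descents` and `normalsAt`. After the
  -- exchange of sums, each `S` that defines a face is counted by its unique minimizing vertex, and
  -- any other `S` by none.
  simp_rw [← Finset.sum_powerset_interval_neg_one_pow _ _ U (descents_subset _ ξ)]
  rw [Finset.sum_comm]
  refine Finset.sum_congr rfl fun S _ => ?_
  split_ifs with hS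
  · obtain ⟨p, hp⟩ := h.exists_minimum ξ hS
    rw [Finset.sum_eq_single p, if_pos hp]
    · exact fun q _ hqp => if_neg fun hq => hqp (h.unique_minimum hξ hp hq)
    · simp
  · exact Finset.sum_eq_zero fun p _ => if_neg fun hp => hS ⟨p, hp.2⟩

/-- Some linear form on `ℝⁿ` is nonzero at finitely many given nonzero vectors; its sign can be
chosen to make it negative at `x`. -/
theorem exists_generic [Finite ι] (h : IsSmoothReflexive w l) (x : Fin n → ℤ) (hx : x ≠ 0) :
    ∃ ξ : (Fin n → ℤ) →+ ℝ, (∀ p i, ξ (w p i) ≠ 0) ∧ ξ x < 0 := by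
  let c : (Fin n → ℤ) →+ (Fin n → ℝ) := (Int.castAddHom ℝ).compLeft (Fin n)
  have hc : ∀ y, y ≠ 0 → c y ≠ 0 := by
    intro y hy h0
    refine hy (funext fun i => ?_)
    have := congrFun h0 i
    simpa [c] using this
  have hw : ∀ p i, w p i ≠ 0 := by
    intro p i h0
    have := h.dual p i i
    simp [h0] at this
  obtain ⟨f, hf⟩ := Module.exists_dual_forall_apply_ne_zero (K := ℝ)
    (fun o : Option (ι × Fin n) => c (o.elim x fun a => w a.1 a.2)) (by
      rintro (_ | ⟨p, i⟩)
      · exact hc x hx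
      · exact hc _ (hw p i))
  have hfx : f (c x) ≠ 0 := hf none
  have hfw : ∀ p i, f (c (w p i)) ≠ 0 := fun p i => hf (some (p, i))
  rcases hfx.lt_or_gt with h1 | h1
  · exact ⟨f.toAddMonoidHom.comp c, hfw, h1⟩
  · exact ⟨(-f).toAddMonoidHom.comp c, fun p i => by simpa using hfw p i, by simpa using h1⟩

/-! ### Cone decomposition and the localization formula. -/

/-- The polar decomposition of the tangent cones: an alternating sum of half-open cones is the
indicator function of the origin. -/
theorem sum_cones [Fintype ι] [Nonempty ι] (h : IsSmoothReflexive w l) {ξ : (Fin n → ℤ) →+ ℝ}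
    (hξ : ∀ p i, ξ (w p i) ≠ 0) (x : Fin n → ℤ) :
    (∑ p, if ∀ i, 0 ≤ -(x ⬝ᵥ l p i) ↔ 0 < ξ (w p i) then
        (-1 : ℝ) ^ (descents w l ξ p).card else 0) = if x = 0 then 1 else 0 := by
  classical
  -- `U` collects the normals for which `x` has a negative coordinate. Lying in the half-open cone
  -- at `p` means that these are, among the normals at `p`, exactly the descents.
  set U : Finset (Fin n → ℤ) := (univ.biUnion (normalsAt l)).filter fun a => 0 < x ⬝ᵥ a
  have hU : ∀ p i, l p i ∈ U ↔ 0 < x ⬝ᵥ l p i := by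
    intro p i
    simp only [U, Finset.mem_filter, Finset.mem_biUnion, mem_univ, true_and, and_iff_right_iff_imp]
    exact fun _ => ⟨p, Finset.mem_image.mpr ⟨i, mem_univ _, rfl⟩⟩
  have key : ∀ η : (Fin n → ℤ) →+ ℝ, (∀ p i, η (w p i) ≠ 0) → ∀ p,
      ((∀ i, 0 ≤ -(x ⬝ᵥ l p i) ↔ 0 < η (w p i)) ↔
        descents w l η p = normalsAt l p ∩ U) := by
    intro η hη p
    have hd : descents w l η p = normalsAt l p ∩ U ↔
        ∀ i, l p i ∈ descents w l η p ↔ l p i ∈ U := by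
      constructor
      · intro hd i
        rw [hd, Finset.mem_inter]
        exact and_iff_right (Finset.mem_image.mpr ⟨i, mem_univ _, rfl⟩)
      · intro hd
        ext a
        rw [Finset.mem_inter]
        constructor
        · intro ha
          have hb := descents_subset p η ha
          obtain ⟨i, -, rfl⟩ := Finset.mem_image.mp hb
          exact ⟨hb, (hd i).mp ha⟩
        · rintro ⟨hb, ha⟩
          obtain ⟨i, -, rfl⟩ := Finset.mem_image.mp hb
          exact (hd i).mpr ha
    rw [hd]
    refine forall_congr' fun i => ?_
    rw [h.mem_descents_iff, hU]
    have h1 := hη p i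
    constructor
    · intro h2
      rw [← not_iff_not, not_lt, not_lt, ← neg_nonneg (a := x ⬝ᵥ l p i), h2]
      exact ⟨fun h3 => lt_of_le_of_ne h3 h1.symm, le_of_lt⟩
    · intro h2
      rw [neg_nonneg, ← not_lt, ← h2, not_lt]
      exact ⟨fun h3 => lt_of_le_of_ne h3 h1.symm, le_of_lt⟩
  simp only [key ξ hξ]
  rw [h.sum_descents_eq hξ]
  split_ifs with hx
  -- For `x = 0` only `S = ∅` remains; it contributes 1 because there is a vertex.
  · have : U = ∅ := by
      subst hx
      simp [U]
    simp [this]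
  -- The sum depends only on `U`, hence `ξ` may be replaced by a generic `η` with `η x < 0`. Every
  -- half-open cone for `η` lies where `η` is nonnegative, so none contains `x`.
  · obtain ⟨η, hη, hηx⟩ := h.exists_generic x hx
    rw [← h.sum_descents_eq hη]
    refine Finset.sum_eq_zero fun p _ => if_neg fun hp => ?_
    rw [← key η hη] at hp
    rw [h.map_eq_sum p] at hηx
    refine hηx.not_ge (Finset.sum_nonneg fun i _ => ?_)
    by_cases h1 : 0 < η (w p i)
    · exact mul_nonneg (Int.cast_nonneg ((hp i).mpr h1)) h1.le
    · have h2 : -(x ⬝ᵥ l p i) ≤ 0 := not_lt.mp fun h3 => h1 ((hp i).mp h3.le)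
      exact mul_nonneg_of_nonpos_of_nonpos (Int.cast_nonpos.mpr h2) (not_lt.mp h1)

/-- The expansion of a product of geometric series over the lattice. -/
theorem prod_geomTerm (h : IsSmoothReflexive w l) {ξ : (Fin n → ℤ) →+ ℝ}
    (hξ : ∀ p i, ξ (w p i) ≠ 0) (p : ι) (x : Fin n → ℤ) :
    ∏ i, geomTerm (ξ (w p i)) (-(x ⬝ᵥ l p i)) =
      (if ∀ i, 0 ≤ -(x ⬝ᵥ l p i) ↔ 0 < ξ (w p i) then
        (-1 : ℝ) ^ (descents w l ξ p).card else 0) * Real.exp (-ξ x) := by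
  split_ifs with hc
  · have h1 : ∀ i, geomTerm (ξ (w p i)) (-(x ⬝ᵥ l p i)) =
        (if 0 < ξ (w p i) then 1 else -1) *
          Real.exp (-(((-(x ⬝ᵥ l p i) : ℤ) : ℝ) * ξ (w p i))) := fun i => if_pos (hc i)
    simp only [h1]
    rw [Finset.prod_mul_distrib, ← Real.exp_sum, Finset.sum_neg_distrib, ← h.map_eq_sum,
      Finset.prod_ite, h.card_descents, Finset.prod_const, Finset.prod_const, one_pow, one_mul]
    congr 3
    refine Finset.filter_congr fun i _ => ?_
    rw [not_lt]
    exact ⟨fun h2 => lt_of_le_of_ne h2 (hξ p i), le_of_lt⟩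
  · push Not at hc
    obtain ⟨i, hi⟩ := hc
    rw [zero_mul]
    refine Finset.prod_eq_zero (mem_univ i) (if_neg fun h1 => ?_)
    rcases hi with h2 | h2
    · exact (h1.mp h2.1).not_ge h2.2
    · exact h2.1.not_ge (h1.mpr h2.2)

/-- The coordinates of lattice vectors with respect to the edge directions at a vertex. -/
def coordEquiv (h : IsSmoothReflexive w l) (p : ι) : (Fin n → ℤ) ≃ (Fin n → ℤ) where
  toFun x i := -(x ⬝ᵥ l p i)
  invFun c := ∑ i, c i • w p i
  left_inv x := (h.eq_sum p x).symm
  right_inv c := by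
    funext j
    change -((∑ i, c i • w p i) ⬝ᵥ l p j) = c j
    simp only [sum_dotProduct, smul_dotProduct, h.dual]
    simp

/-- The localization formula for the Todd genus of a smooth reflexive polytope. -/
theorem sum_prod_inv_one_sub_exp [Fintype ι] [Nonempty ι] (h : IsSmoothReflexive w l)
    {ξ : (Fin n → ℤ) →+ ℝ} (hξ : ∀ p i, ξ (w p i) ≠ 0) :
    ∑ p, ∏ i, (1 - Real.exp (-ξ (w p i)))⁻¹ = 1 := by
  -- `coordEquiv` reindexes the series of every vertex by the common lattice, so that they can be
  -- added term by term.
  have h1 : ∀ p, HasSum (fun x => ∏ i, geomTerm (ξ (w p i)) (-(x ⬝ᵥ l p i)))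
      (∏ i, (1 - Real.exp (-ξ (w p i)))⁻¹) := fun p => by
    have h0 : HasSum (fun c : Fin n → ℤ => ∏ i, geomTerm (ξ (w p i)) (c i))
      (∏ i, (1 - Real.exp (-ξ (w p i)))⁻¹) := hasSum_prod_pi fun i => hasSum_geomTerm (hξ p i)
    rw [← (h.coordEquiv p).hasSum_iff] at h0
    exact h0
  have h2 := hasSum_sum fun p (_ : p ∈ univ) => h1 p
  have h3 : (fun x => ∑ p, ∏ i, geomTerm (ξ (w p i)) (-(x ⬝ᵥ l p i))) =
      fun x => if x = 0 then 1 else 0 := by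
    funext x
    simp_rw [h.prod_geomTerm hξ]
    rw [← Finset.sum_mul, h.sum_cones hξ]
    split_ifs with hx
    · simp [hx]
    · simp
  rw [h3] at h2
  exact h2.unique (hasSum_ite_eq 0 1)

end IsSmoothReflexive

end LatticePolytope

/-! ### Laurent expansion of the Todd function. -/

open Filter Topology

/-- The odd part of `u ↦ 1 / (1 - exp (-u))`. -/
noncomputable def toddOdd (u : ℝ) : ℝ := (1 - Real.exp (-u))⁻¹ - 1 / 2

theorem toddOdd_neg {u : ℝ} (hu : u ≠ 0) : toddOdd (-u) = -toddOdd u := by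
  have h1 : 1 - Real.exp u ≠ 0 := by
    rw [sub_ne_zero, ne_comm, Ne, Real.exp_eq_one_iff]; exact hu
  have h2 : 1 - Real.exp (-u) ≠ 0 := by
    rw [sub_ne_zero, ne_comm, Ne, Real.exp_eq_one_iff]; exact neg_ne_zero.mpr hu
  have h3 : Real.exp u * Real.exp (-u) = 1 := by rw [← Real.exp_add]; simp
  simp only [toddOdd, neg_neg]
  field_simp
  linear_combination -2 * h3

/-- The expansion `1 / u + u / 12 + o(u)` of the odd part of the Todd function. -/
theorem tendsto_toddOdd :
    Tendsto (fun u => (toddOdd u - 1 / u) / u) (𝓝[≠] 0) (𝓝 (1 / 12)) := by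
  have hexp : ∀ u : ℝ, |u| ≤ 1 →
      |Real.exp (-u) - (1 - u + u ^ 2 / 2 - u ^ 3 / 6)| ≤ |u| ^ 4 := by
    intro u hu
    have := Real.exp_bound (x := -u) (by rwa [abs_neg]) (n := 4) (by norm_num)
    rw [abs_neg] at this
    simp only [Finset.sum_range_succ, Finset.sum_range_zero, Nat.factorial] at this
    refine le_trans (le_of_eq ?_) (this.trans ?_)
    · congr 1
      push_cast
      ring
    · have h4 : 0 ≤ |u| ^ 4 := by positivity
      norm_num
      nlinarith
  have hr : Tendsto (fun u : ℝ =>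
      (Real.exp (-u) - (1 - u + u ^ 2 / 2 - u ^ 3 / 6)) / u ^ 3) (𝓝[≠] 0) (𝓝 0) := by
    have hlim : Tendsto (fun u : ℝ => |u|) (𝓝[≠] 0) (𝓝 0) := by
      have : Tendsto (fun u : ℝ => |u|) (𝓝 0) (𝓝 |0|) := continuous_abs.tendsto 0
      rw [abs_zero] at this
      exact this.mono_left nhdsWithin_le_nhds
    refine squeeze_zero_norm' ?_ hlim
    have h1 : ∀ᶠ u : ℝ in 𝓝[≠] 0, |u| < 1 := hlim.eventually (gt_mem_nhds one_pos)
    filter_upwards [h1, self_mem_nhdsWithin] with u hu hu0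
    have hpos : 0 < |u| := abs_pos.mpr hu0
    rw [Real.norm_eq_abs, abs_div, abs_pow, div_le_iff₀ (by positivity)]
    exact (hexp u hu.le).trans_eq (by ring)
  have hid : Tendsto (fun u : ℝ => u) (𝓝[≠] 0) (𝓝 0) := tendsto_id.mono_left nhdsWithin_le_nhds
  -- Let `r` be the Taylor remainder of `exp (-u)` divided by `u ^ 3`. Cancelling `u ^ 3` turns the
  -- quotient into `(r * (u + 2) + 1 / 6 - u / 6) / (2 * (1 - u / 2 + u ^ 2 / 6 - r * u ^ 2))`,
  -- which has no singularity at 0.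
  have hlim := ((hr.mul (hid.add_const (2 : ℝ))).add_const (1 / 6 : ℝ)).sub (hid.div_const 6)
  have hden := ((hid.div_const 2).neg.add_const (1 : ℝ)).add ((hid.pow 2).div_const 6)
    |>.sub ((hr.mul (hid.pow 2))) |>.const_mul 2
  have hq := hlim.div hden (by norm_num)
  have hval : ((0 * (0 + 2) + 1 / 6 - 0 / 6) /
      (2 * (-(0 / 2) + 1 + 0 ^ 2 / 6 - 0 * 0 ^ 2)) : ℝ) = 1 / 12 := by norm_num
  rw [hval] at hq
  refine hq.congr' ?_
  filter_upwards [self_mem_nhdsWithin] with u hu0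
  have hu : u ≠ 0 := hu0
  have h1 : 1 - Real.exp (-u) ≠ 0 := by
    rw [sub_ne_zero, ne_comm, Ne, Real.exp_eq_one_iff]; exact neg_ne_zero.mpr hu
  simp only [Pi.div_apply, toddOdd]
  generalize Real.exp (-u) = E at h1
  have h2 : 2 * (-(u / 2) + 1 + u ^ 2 / 6 - (E - (1 - u + u ^ 2 / 2 - u ^ 3 / 6)) / u ^ 3 * u ^ 2) =
      2 * (1 - E) / u := by
    field_simp
    ring
  rw [h2]
  field_simp
  ring

/-- The constant term of a product of two odd parts of Todd functions. -/
theorem tendsto_toddOdd_mul {a b : ℝ} (ha : a ≠ 0) (hb : b ≠ 0) :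
    Tendsto (fun t => toddOdd (t * a) * toddOdd (t * b) - 1 / (a * b) / t ^ 2) (𝓝[≠] 0)
      (𝓝 ((a / b + b / a) / 12)) := by
  have hs : ∀ c : ℝ, c ≠ 0 → Tendsto (fun t : ℝ => t * c) (𝓝[≠] 0) (𝓝[≠] 0) := by
    intro c hc
    refine tendsto_nhdsWithin_iff.mpr ⟨?_, ?_⟩
    · have : Tendsto (fun t : ℝ => t * c) (𝓝 0) (𝓝 (0 * c)) :=
        (continuous_mul_const c).tendsto 0
      rw [zero_mul] at this
      exact this.mono_left nhdsWithin_le_nhds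
    · filter_upwards [self_mem_nhdsWithin] with t ht
      exact mul_ne_zero ht hc
  have h1 := tendsto_toddOdd.comp (hs a ha)
  have h2 := tendsto_toddOdd.comp (hs b hb)
  have hid : Tendsto (fun u : ℝ => u) (𝓝[≠] 0) (𝓝 0) := tendsto_id.mono_left nhdsWithin_le_nhds
  -- With `toddOdd u = 1 / u + g u * u`, the product minus its pole is `g (t * a) * (a / b) + g (t *
  -- b) * (b / a) + g (t * a) * g (t * b) * t ^ 2 * (a * b)`.
  have h3 := ((h1.mul_const (a / b)).add (h2.mul_const (b / a))).add
    (((h1.mul h2).mul (hid.pow 2)).mul_const (a * b))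
  have hval : (1 / 12 * (a / b) + 1 / 12 * (b / a) + 1 / 12 * (1 / 12) * 0 ^ 2 * (a * b) : ℝ) =
    (a / b + b / a) / 12 := by ring
  rw [hval] at h3
  refine h3.congr' ?_
  filter_upwards [self_mem_nhdsWithin] with t ht
  have ht' : t ≠ 0 := ht
  simp only [Function.comp]
  field_simp
  ring

/-- A sum of a constant and a multiple of `1 / t ^ 2` that tends to a limit has no polar part. -/
theorem eq_of_tendsto_sub_div_sq {f : ℝ → ℝ} {A C D : ℝ} (hf : ∀ t, t ≠ 0 → f t = A)
    (h : Tendsto (fun t => f t - C / t ^ 2) (𝓝[≠] 0) (𝓝 D)) : D = A := by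
  have hid : Tendsto (fun u : ℝ => u ^ 2) (𝓝[≠] 0) (𝓝 (0 ^ 2)) :=
    (tendsto_id.pow 2).mono_left nhdsWithin_le_nhds
  have h1 : Tendsto (fun t => A - C / t ^ 2) (𝓝[≠] 0) (𝓝 D) := by
    refine h.congr' ?_
    filter_upwards [self_mem_nhdsWithin] with t ht
    rw [hf t ht]
  -- Multiplication by `t ^ 2` isolates `C` and shows that it is zero.
  have h2 : Tendsto (fun t => t ^ 2 * A - t ^ 2 * (A - C / t ^ 2)) (𝓝[≠] 0)
      (𝓝 (0 ^ 2 * A - 0 ^ 2 * D)) := (hid.mul_const A).sub (hid.mul h1)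
  have h3 : Tendsto (fun _ : ℝ => C) (𝓝[≠] 0) (𝓝 (0 ^ 2 * A - 0 ^ 2 * D)) := by
    refine h2.congr' ?_
    filter_upwards [self_mem_nhdsWithin] with t ht
    have ht' : t ≠ 0 := ht
    field_simp
    ring
  have hC : C = 0 := by simpa using tendsto_nhds_unique tendsto_const_nhds h3
  rw [hC] at h1
  simp only [zero_div, sub_zero] at h1
  exact tendsto_nhds_unique h1 tendsto_const_nhds

/-! ### Constant terms in dimensions two and three. -/

namespace LatticePolytope

namespace IsSmoothReflexive

variable {ι : Type*} [Fintype ι] [Nonempty ι]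

theorem sum_prod_toddOdd {n : ℕ} {w l : ι → Fin n → (Fin n → ℤ)} (h : IsSmoothReflexive w l)
    {ξ : (Fin n → ℤ) →+ ℝ} (hξ : ∀ p i, ξ (w p i) ≠ 0) {t : ℝ} (ht : t ≠ 0) :
    ∑ p, ∏ i, (1 / 2 + toddOdd (t * ξ (w p i))) = 1 := by
  have := h.sum_prod_inv_one_sub_exp (ξ := (AddMonoidHom.mulLeft t).comp ξ)
    fun p i => mul_ne_zero ht (hξ p i)
  simpa [toddOdd] using this

/-- This is the formula at `-t`. Added to the one at `t`, it leaves only the products of an even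
number of odd parts. -/
theorem sum_prod_toddOdd_neg {n : ℕ} {w l : ι → Fin n → (Fin n → ℤ)} (h : IsSmoothReflexive w l)
    {ξ : (Fin n → ℤ) →+ ℝ} (hξ : ∀ p i, ξ (w p i) ≠ 0) {t : ℝ} (ht : t ≠ 0) :
    ∑ p, ∏ i, (1 / 2 - toddOdd (t * ξ (w p i))) = 1 := by
  refine Eq.trans ?_ (h.sum_prod_toddOdd hξ (neg_ne_zero.mpr ht))
  refine Finset.sum_congr rfl fun p _ => Finset.prod_congr rfl fun i _ => ?_
  rw [neg_mul, toddOdd_neg (mul_ne_zero ht (hξ p i)), sub_eq_add_neg]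

/-- Write `N` for the number of vertices. The even part of the localization formula is `N / 4 + ∑ p,
toddOdd * toddOdd = 1`, so the off-diagonal ratios add up to `12 - 3 * N`. The diagonal ones give `2
* N`, and one `N` is left over. -/
theorem sum_ratio_two {w l : ι → Fin 2 → (Fin 2 → ℤ)} (h : IsSmoothReflexive w l)
    {ξ : (Fin 2 → ℤ) →+ ℝ} (hξ : ∀ p i, ξ (w p i) ≠ 0) :
    ∑ p, ∑ i, ∑ j, ξ (w p j) / ξ (w p i) + Fintype.card ι = 12 := by
  have h1 := tendsto_finsetSum Finset.univ fun p (_ : p ∈ Finset.univ) =>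
    tendsto_toddOdd_mul (hξ p 0) (hξ p 1)
  simp only [Finset.sum_sub_distrib, ← Finset.sum_div] at h1
  have h2 := eq_of_tendsto_sub_div_sq (A := 1 - (Fintype.card ι : ℝ) / 4) (fun t ht => ?_) h1
  · simp only [Fin.sum_univ_two, div_self (hξ _ _)]
    have h3 : ∑ p, (1 + ξ (w p 1) / ξ (w p 0) + (ξ (w p 0) / ξ (w p 1) + 1)) =
        2 * (Fintype.card ι : ℝ) +
          ∑ p, (ξ (w p 0) / ξ (w p 1) + ξ (w p 1) / ξ (w p 0)) := by
      rw [← Finset.card_univ, mul_comm, ← nsmul_eq_mul, ← Finset.sum_const,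
        ← Finset.sum_add_distrib]
      exact Finset.sum_congr rfl fun p _ => by ring
    rw [h3]
    linarith
  · have h3 := h.sum_prod_toddOdd hξ ht
    have h4 := h.sum_prod_toddOdd_neg hξ ht
    have h5 : ∑ p, ∏ i, (1 / 2 + toddOdd (t * ξ (w p i))) +
        ∑ p, ∏ i, (1 / 2 - toddOdd (t * ξ (w p i))) = (Fintype.card ι : ℝ) * (1 / 2) +
          2 * ∑ p, toddOdd (t * ξ (w p 0)) * toddOdd (t * ξ (w p 1)) := by
      rw [← Finset.card_univ, ← nsmul_eq_mul, ← Finset.sum_const, Finset.mul_sum,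
        ← Finset.sum_add_distrib, ← Finset.sum_add_distrib]
      refine Finset.sum_congr rfl fun p _ => ?_
      simp only [Fin.prod_univ_two]
      ring
    linarith

/-- Here the even part is `N / 8` plus half the sum of the pairwise products. The off-diagonal
ratios add up to `24 - 3 * N` and the diagonal ones to `3 * N`, so the number of vertices cancels.
-/
theorem sum_ratio_three {w l : ι → Fin 3 → (Fin 3 → ℤ)} (h : IsSmoothReflexive w l)
    {ξ : (Fin 3 → ℤ) →+ ℝ} (hξ : ∀ p i, ξ (w p i) ≠ 0) :
    ∑ p, ∑ i, ∑ j, ξ (w p j) / ξ (w p i) = 24 := by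
  have h1 := tendsto_finsetSum Finset.univ fun p (_ : p ∈ Finset.univ) =>
    ((tendsto_toddOdd_mul (hξ p 0) (hξ p 1)).add (tendsto_toddOdd_mul (hξ p 0) (hξ p 2))).add
      (tendsto_toddOdd_mul (hξ p 1) (hξ p 2))
  have h2 := eq_of_tendsto_sub_div_sq (A := 2 - (Fintype.card ι : ℝ) / 4)
    (f := fun t => ∑ p, (toddOdd (t * ξ (w p 0)) * toddOdd (t * ξ (w p 1)) +
      toddOdd (t * ξ (w p 0)) * toddOdd (t * ξ (w p 2)) +
      toddOdd (t * ξ (w p 1)) * toddOdd (t * ξ (w p 2))))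
    (C := ∑ p, (1 / (ξ (w p 0) * ξ (w p 1)) + 1 / (ξ (w p 0) * ξ (w p 2)) +
      1 / (ξ (w p 1) * ξ (w p 2)))) (fun t ht => ?_) (h1.congr fun t => ?_)
  · have h3 : ∑ p, ∑ i, ∑ j, ξ (w p j) / ξ (w p i) = 3 * (Fintype.card ι : ℝ) +
        12 * ∑ p, ((ξ (w p 0) / ξ (w p 1) + ξ (w p 1) / ξ (w p 0)) / 12 +
          (ξ (w p 0) / ξ (w p 2) + ξ (w p 2) / ξ (w p 0)) / 12 +
          (ξ (w p 1) / ξ (w p 2) + ξ (w p 2) / ξ (w p 1)) / 12) := by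
      rw [← Finset.card_univ, mul_comm, ← nsmul_eq_mul, ← Finset.sum_const, Finset.mul_sum,
        ← Finset.sum_add_distrib]
      refine Finset.sum_congr rfl fun p _ => ?_
      simp only [Fin.sum_univ_three, div_self (hξ _ _)]
      ring
    rw [h3, h2]
    ring
  · have h3 := h.sum_prod_toddOdd hξ ht
    have h4 := h.sum_prod_toddOdd_neg hξ ht
    have h5 : ∑ p, ∏ i, (1 / 2 + toddOdd (t * ξ (w p i))) +
        ∑ p, ∏ i, (1 / 2 - toddOdd (t * ξ (w p i))) = (Fintype.card ι : ℝ) * (1 / 4) +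
          ∑ p, (toddOdd (t * ξ (w p 0)) * toddOdd (t * ξ (w p 1)) +
            toddOdd (t * ξ (w p 0)) * toddOdd (t * ξ (w p 2)) +
            toddOdd (t * ξ (w p 1)) * toddOdd (t * ξ (w p 2))) := by
      rw [← Finset.card_univ, ← nsmul_eq_mul, ← Finset.sum_const,
        ← Finset.sum_add_distrib, ← Finset.sum_add_distrib]
      refine Finset.sum_congr rfl fun p _ => ?_
      simp only [Fin.prod_univ_three]
      ring
    linarith
  · rw [Finset.sum_div, ← Finset.sum_sub_distrib]
    refine Finset.sum_congr rfl fun p _ => ?_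
    ring

end IsSmoothReflexive

end LatticePolytope

/-! ### Integral vectors, facet inequalities and exposed faces. -/

namespace LatticePolytope

open Filter Topology

variable {n : ℕ}

theorem intVec_apply (w : Fin n → ℤ) (i : Fin n) : intVec w i = w i := rfl

theorem inner_intVec (x : EuclideanSpace ℝ (Fin n)) (l : Fin n → ℤ) :
    ⟪x, intVec l⟫_ℝ = ∑ i, x i * l i := by
  simp [PiLp.inner_apply, intVec_apply, mul_comm]

theorem inner_intVec_intVec (w l : Fin n → ℤ) :
    ⟪intVec w, intVec l⟫_ℝ = ((w ⬝ᵥ l : ℤ) : ℝ) := by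
  rw [inner_intVec]
  simp [dotProduct, intVec_apply]

theorem intVec_injective : Function.Injective (intVec (n := n)) := by
  intro a b h
  funext i
  have := congrArg (fun x : EuclideanSpace ℝ (Fin n) => x i) h
  simpa [intVec_apply] using this

theorem intVec_add (a b : Fin n → ℤ) : intVec (a + b) = intVec a + intVec b := by
  ext i; simp [intVec_apply]

theorem intVec_neg (a : Fin n → ℤ) : intVec (-a) = -intVec a := by
  ext i; simp [intVec_apply]

theorem intVec_zsmul (t : ℤ) (a : Fin n → ℤ) : intVec (t • a) = (t : ℝ) • intVec a := by
  ext i; simp [intVec_apply]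

theorem intVec_sum {κ : Type*} (s : Finset κ) (f : κ → Fin n → ℤ) :
    intVec (∑ i ∈ s, f i) = ∑ i ∈ s, intVec (f i) := by
  ext i; simp [intVec_apply]

/-- The expansion of an integral vector in a basis, and of the dual one. -/
theorem sum_dual_entries {w l : Fin n → (Fin n → ℤ)}
    (h : ∀ i j, w i ⬝ᵥ l j = if i = j then -1 else 0) (a b : Fin n) :
    ∑ i, l i a * w i b = if a = b then -1 else 0 := by
  have h1 : Matrix.of w * (-(Matrix.of l).transpose) = 1 := by
    ext i j
    have : (Matrix.of w * (Matrix.of l).transpose) i j = w i ⬝ᵥ l j := rfl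
    rw [Matrix.mul_neg, Matrix.neg_apply, this, h, Matrix.one_apply]
    split_ifs <;> simp
  have h0 := mul_eq_one_comm.mp h1
  have h2 := congrFun (congrFun h0 a) b
  rw [Matrix.neg_mul, Matrix.neg_apply, Matrix.one_apply] at h2
  have h3 : ((Matrix.of l).transpose * Matrix.of w) a b = ∑ i, l i a * w i b := rfl
  rw [h3] at h2
  split_ifs at h2 ⊢ <;> omega

theorem eq_sum_inner {w l : Fin n → (Fin n → ℤ)}
    (h : ∀ i j, w i ⬝ᵥ l j = if i = j then -1 else 0) (x : EuclideanSpace ℝ (Fin n)) :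
    x = ∑ i, (-⟪x, intVec (l i)⟫_ℝ) • intVec (w i) := by
  ext b
  have h1 : ∀ a, ∑ i, (l i a : ℝ) * w i b = if a = b then -1 else 0 := fun a => by
    exact_mod_cast congrArg (Int.cast : ℤ → ℝ) (sum_dual_entries h a b)
  simp only [inner_intVec, WithLp.ofLp_sum, WithLp.ofLp_smul, Finset.sum_apply, Pi.smul_apply,
    intVec_apply, smul_eq_mul, neg_mul, Finset.sum_neg_distrib, Finset.sum_mul, mul_assoc]
  rw [Finset.sum_comm]
  simp_rw [← Finset.mul_sum, h1]
  simp

theorem eq_sum_dual {w l : Fin n → (Fin n → ℤ)}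
    (h : ∀ i j, w i ⬝ᵥ l j = if i = j then -1 else 0) (x : Fin n → ℤ) :
    x = ∑ i, (-(w i ⬝ᵥ x)) • l i := by
  funext a
  have h1 := fun b => sum_dual_entries h a b
  simp only [dotProduct, Finset.sum_apply, Pi.smul_apply, smul_eq_mul, neg_mul,
    Finset.sum_neg_distrib, Finset.sum_mul]
  rw [Finset.sum_comm]
  have h2 : ∀ b, ∑ i, w i b * x b * l i a = x b * if a = b then -1 else 0 := fun b => by
    rw [← h1 b, Finset.mul_sum]
    exact Finset.sum_congr rfl fun i _ => by ring
  simp_rw [h2]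
  simp

theorem isPrimitiveVec_of_dotProduct {w l : Fin n → ℤ} (h : w ⬝ᵥ l = -1) : IsPrimitiveVec w := by
  rintro m w' rfl
  rw [smul_dotProduct, smul_eq_mul] at h
  have : IsUnit m := IsUnit.of_mul_eq_one (-(w' ⬝ᵥ l)) (by linarith)
  exact Int.isUnit_iff.mp this

/-- Strict inequalities survive a small displacement. -/
theorem eventually_inner_le {B : Set (Fin n → ℤ)} (hB : B.Finite) {c : ℝ}
    {x u : EuclideanSpace ℝ (Fin n)} (hx : ∀ l ∈ B, ⟪x, intVec l⟫_ℝ ≤ c)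
    (hu : ∀ l ∈ B, ⟪x, intVec l⟫_ℝ = c → ⟪u, intVec l⟫_ℝ ≤ 0) :
    ∀ᶠ ε : ℝ in 𝓝[>] 0, ∀ l ∈ B, ⟪x + ε • u, intVec l⟫_ℝ ≤ c := by
  rw [Filter.eventually_all_finite hB]
  intro l hl
  rcases (hx l hl).lt_or_eq with h | h
  · have hc : Continuous fun ε : ℝ => ⟪x + ε • u, intVec l⟫_ℝ := by fun_prop
    have h1 : Tendsto (fun ε : ℝ => ⟪x + ε • u, intVec l⟫_ℝ) (𝓝[>] 0) (𝓝 ⟪x, intVec l⟫_ℝ) := by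
      have := (hc.tendsto 0).mono_left (nhdsWithin_le_nhds (s := Set.Ioi 0))
      simpa using this
    filter_upwards [h1.eventually (gt_mem_nhds h)] with ε hε using hε.le
  · filter_upwards [self_mem_nhdsWithin] with ε hε
    rw [inner_add_left, real_inner_smul_left, h]
    have := mul_nonpos_of_nonneg_of_nonpos (le_of_lt hε) (hu l hl h)
    linarith

theorem eq_zero_of_mem_extremePoints {K : Set (EuclideanSpace ℝ (Fin n))}
    {x u : EuclideanSpace ℝ (Fin n)} (hx : x ∈ K.extremePoints ℝ) {ε : ℝ} (hε : 0 < ε)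
    (h1 : x + ε • u ∈ K) (h2 : x + ε • -u ∈ K) : u = 0 := by
  have h3 := hx.2 h1 h2 ⟨1 / 2, 1 / 2, by norm_num, by norm_num, by norm_num, by module⟩
  have h4 : ε • u = 0 := by simpa using h3
  exact (smul_eq_zero.mp h4).resolve_left hε.ne'

/-- The face of `Δ` on which all the inequalities of a finite set are equalities. -/
theorem isExposed_inner_eq {Δ : Set (EuclideanSpace ℝ (Fin n))} {A : Set (Fin n → ℤ)}
    (hA : A.Finite) (hΔ : ∀ x ∈ Δ, ∀ l ∈ A, ⟪x, intVec l⟫_ℝ ≤ 1) {v : EuclideanSpace ℝ (Fin n)}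
    (hv : v ∈ Δ) (hvA : ∀ l ∈ A, ⟪v, intVec l⟫_ℝ = 1) :
    IsExposed ℝ Δ {x ∈ Δ | ∀ l ∈ A, ⟪x, intVec l⟫_ℝ = 1} := by
  intro _
  -- The sum of the normals is at most `|A|` on `Δ`, with equality exactly when all the inequalities
  -- are tight; `v` shows that the bound is attained.
  refine ⟨innerSL ℝ (∑ l ∈ hA.toFinset, intVec l), ?_⟩
  have hval : ∀ x, innerSL ℝ (∑ l ∈ hA.toFinset, intVec l) x =
      ∑ l ∈ hA.toFinset, ⟪x, intVec l⟫_ℝ := fun x => by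
    rw [innerSL_apply_apply, sum_inner]
    exact Finset.sum_congr rfl fun l _ => real_inner_comm _ _
  have hle : ∀ y ∈ Δ, ∀ l ∈ hA.toFinset, ⟪y, intVec l⟫_ℝ ≤ 1 := fun y hy l hl =>
    hΔ y hy l (hA.mem_toFinset.mp hl)
  ext x
  simp only [Set.mem_ofPred_eq, hval]
  refine and_congr_right fun hx => ⟨fun h y hy => ?_, fun h l hl => ?_⟩
  · refine Finset.sum_le_sum fun l hl => ?_
    rw [h l (hA.mem_toFinset.mp hl)]
    exact hle y hy l hl
  · have h1 : ∑ l ∈ hA.toFinset, ⟪x, intVec l⟫_ℝ = ∑ l ∈ hA.toFinset, (1 : ℝ) := by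
      refine le_antisymm (Finset.sum_le_sum (hle x hx)) ?_
      refine le_trans (le_of_eq ?_) (h v hv)
      exact Finset.sum_congr rfl fun l hl => (hvA l (hA.mem_toFinset.mp hl)).symm
    exact (Finset.sum_eq_sum_iff_of_le (hle x hx)).mp h1 l (hA.mem_toFinset.mpr hl)

theorem IsPolytope.isCompact {Δ : Set (EuclideanSpace ℝ (Fin n))} (h : IsPolytope Δ) :
    IsCompact Δ := by
  obtain ⟨S, hS, rfl⟩ := h
  exact hS.isCompact_convexHull ℝ

theorem IsPolytope.convex {Δ : Set (EuclideanSpace ℝ (Fin n))} (h : IsPolytope Δ) :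
    Convex ℝ Δ := by
  obtain ⟨S, hS, rfl⟩ := h
  exact convex_convexHull ℝ S

theorem IsPolytope.finite_extremePoints {Δ : Set (EuclideanSpace ℝ (Fin n))} (h : IsPolytope Δ) :
    (Δ.extremePoints ℝ).Finite := by
  obtain ⟨S, hS, rfl⟩ := h
  exact hS.subset extremePoints_convexHull_subset

theorem IsVertex.mem_extremePoints {Δ : Set (EuclideanSpace ℝ (Fin n))}
    {v : EuclideanSpace ℝ (Fin n)} (h : IsVertex Δ v) : v ∈ Δ.extremePoints ℝ :=
  isExtreme_singleton.mp h.2.1.isExtreme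

theorem isVertex_of_isExposed {Δ : Set (EuclideanSpace ℝ (Fin n))}
    {v : EuclideanSpace ℝ (Fin n)} (h : IsExposed ℝ Δ {v}) : IsVertex Δ v :=
  ⟨Set.singleton_nonempty v, h, by simp [affDim, vectorSpan_singleton]⟩

theorem IsVertex.mem {Δ : Set (EuclideanSpace ℝ (Fin n))}
    {v : EuclideanSpace ℝ (Fin n)} (h : IsVertex Δ v) : v ∈ Δ := h.mem_extremePoints.1

/-! ### Vertices and tangent cones of a reflexive polytope. -/

namespace IsReflexive

variable {Δ : Set (EuclideanSpace ℝ (Fin n))}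

theorem mem_iff (h : IsReflexive Δ) {x : EuclideanSpace ℝ (Fin n)} :
    x ∈ Δ ↔ ∀ l ∈ facetNormals Δ, ⟪x, intVec l⟫_ℝ ≤ 1 := by
  conv_lhs => rw [h.eq_iInter]
  simp

/-- A ball of radius `r` about 0 lies in `Δ`. The inequalities at `±(r / 2)` times the standard
basis vectors bound all entries of a normal by `2 / r`. -/
theorem finite_facetNormals (h : IsReflexive Δ) : (facetNormals Δ).Finite := by
  obtain ⟨r, hr, hball⟩ := Metric.mem_nhds_iff.mp (mem_interior_iff_mem_nhds.mp h.zero_mem_interior)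
  have hcoord : ∀ l ∈ facetNormals Δ, ∀ i, |(l i : ℝ)| ≤ 2 / r := by
    intro l hl i
    have key : ∀ s : ℝ, |s| = 1 → s * l i ≤ 2 / r := by
      intro s hs
      have hmem : EuclideanSpace.single i (s * (r / 2)) ∈ Δ := by
        refine hball ?_
        rw [mem_ball_zero_iff, PiLp.norm_single, Real.norm_eq_abs, abs_mul, hs, one_mul,
          abs_of_pos (by positivity)]
        linarith
      have h1 := h.mem_iff.mp hmem l hl
      rw [inner_intVec, Finset.sum_eq_single i (fun j _ hj => by simp [hj]) (by simp)] at h1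
      rw [le_div_iff₀ hr]
      simp at h1
      linarith
    rw [abs_le']
    exact ⟨by simpa using key 1 (by simp), by simpa using key (-1) (by simp)⟩
  refine (Set.finite_Icc (fun _ : Fin n => -⌈2 / r⌉) (fun _ => ⌈2 / r⌉)).subset fun l hl => ?_
  refine ⟨fun i => ?_, fun i => ?_⟩
  · have h1 := (abs_le.mp (hcoord l hl i)).1
    have h2 := Int.le_ceil (2 / r)
    have h3 : ((-⌈2 / r⌉ : ℤ) : ℝ) ≤ l i := by push_cast; linarith
    exact_mod_cast h3
  · have h1 := (abs_le.mp (hcoord l hl i)).2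
    have h2 := Int.le_ceil (2 / r)
    exact_mod_cast h1.trans h2

/-- The normals of the facets through an extreme point span the space. -/
theorem eq_zero_of_inner_active (h : IsReflexive Δ) {v : EuclideanSpace ℝ (Fin n)}
    (hv : v ∈ Δ.extremePoints ℝ) {u : EuclideanSpace ℝ (Fin n)}
    (hu : ∀ l ∈ facetNormals Δ, ⟪v, intVec l⟫_ℝ = 1 → ⟪u, intVec l⟫_ℝ = 0) : u = 0 := by
  have hvm := h.mem_iff.mp hv.1
  have e1 := eventually_inner_le h.finite_facetNormals hvm fun l hl h1 => (hu l hl h1).le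
  have e2 := eventually_inner_le h.finite_facetNormals hvm (u := -u) fun l hl h1 => by
    rw [inner_neg_left, hu l hl h1, neg_zero]
  obtain ⟨ε, ⟨h1, h2⟩, hε⟩ := ((e1.and e2).and self_mem_nhdsWithin).exists
  exact eq_zero_of_mem_extremePoints hv hε (h.mem_iff.mpr h1) (h.mem_iff.mpr h2)

/-- The active normals at an extreme point span the space, so the face on which they are all tight
is that point alone. -/
theorem isVertex_iff (h : IsReflexive Δ) {v : EuclideanSpace ℝ (Fin n)} :
    IsVertex Δ v ↔ v ∈ Δ.extremePoints ℝ := by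
  refine ⟨IsVertex.mem_extremePoints, fun hv => isVertex_of_isExposed ?_⟩
  set A := {l ∈ facetNormals Δ | ⟪v, intVec l⟫_ℝ = 1}
  have h1 := isExposed_inner_eq (Δ := Δ) (A := A) (h.finite_facetNormals.subset (Set.sep_subset _ _))
    (fun x hx l hl => h.mem_iff.mp hx l hl.1) hv.1 (fun l hl => hl.2)
  convert h1 using 1
  ext x
  simp only [Set.mem_singleton_iff, Set.mem_ofPred_eq]
  constructor
  · rintro rfl
    exact ⟨hv.1, fun l hl => hl.2⟩
  · rintro ⟨-, hx⟩
    refine sub_eq_zero.mp (h.eq_zero_of_inner_active hv fun l hl h2 => ?_)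
    rw [inner_sub_left, hx l ⟨hl, h2⟩, h2, sub_self]

theorem finite_vertices (h : IsReflexive Δ) : {v | IsVertex Δ v}.Finite :=
  h.isPolytope.finite_extremePoints.subset fun _ hv => IsVertex.mem_extremePoints hv

theorem exists_isVertex (h : IsReflexive Δ) : ∃ v, IsVertex Δ v := by
  obtain ⟨v, hv⟩ := h.isPolytope.isCompact.extremePoints_nonempty
    ⟨0, interior_subset h.zero_mem_interior⟩
  exact ⟨v, h.isVertex_iff.mpr hv⟩

/-- A linear form that is nonpositive along all the edges at a vertex `v` is nonpositive on the
tangent cone of the polytope at `v`. -/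
theorem inner_nonpos_of_edges (h : IsReflexive Δ) {v : EuclideanSpace ℝ (Fin n)}
    (hv : IsVertex Δ v) {a : EuclideanSpace ℝ (Fin n)}
    (ha : ∀ e ∈ edgesAt Δ v, ∀ x ∈ e, ⟪x - v, a⟫_ℝ ≤ 0) {d : EuclideanSpace ℝ (Fin n)}
    (hd : ∀ l ∈ facetNormals Δ, ⟪v, intVec l⟫_ℝ = 1 → ⟪d, intVec l⟫_ℝ ≤ 0) :
    ⟪d, a⟫_ℝ ≤ 0 := by
  by_contra! hda
  set B := {l ∈ facetNormals Δ | ⟪v, intVec l⟫_ℝ = 1}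
  have hBfin : B.Finite := h.finite_facetNormals.subset (Set.sep_subset _ _)
  have hB0 : ∀ u : EuclideanSpace ℝ (Fin n), (∀ l ∈ B, ⟪u, intVec l⟫_ℝ = 0) → u = 0 := fun u hu =>
    h.eq_zero_of_inner_active hv.mem_extremePoints fun l hl h1 => hu l ⟨hl, h1⟩
  -- Minus the sum of the active normals is positive on the tangent cone away from 0, so the slice
  -- `φ = 1` is a compact base `K` of the cone.
  let φ : EuclideanSpace ℝ (Fin n) →L[ℝ] ℝ := innerSL ℝ (-∑ l ∈ hBfin.toFinset, intVec l)
  have hφ : ∀ x, φ x = ∑ l ∈ hBfin.toFinset, -⟪x, intVec l⟫_ℝ := fun x => by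
    simp only [φ, innerSL_apply_apply, inner_neg_left, sum_inner, Finset.sum_neg_distrib]
    congr 1
    exact Finset.sum_congr rfl fun l _ => real_inner_comm _ _
  let K : Set (EuclideanSpace ℝ (Fin n)) := {x | (∀ l ∈ B, ⟪x, intVec l⟫_ℝ ≤ 0) ∧ φ x = 1}
  have hK : IsCompact K := by
    have hcl : IsClosed K := by
      refine IsClosed.inter ?_ (isClosed_eq φ.continuous continuous_const)
      have hinter : {x : EuclideanSpace ℝ (Fin n) | ∀ l ∈ B, ⟪x, intVec l⟫_ℝ ≤ 0} =
          ⋂ l ∈ B, {x | ⟪x, intVec l⟫_ℝ ≤ 0} := by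
        ext
        simp
      change IsClosed {x : EuclideanSpace ℝ (Fin n) | ∀ l ∈ B, ⟪x, intVec l⟫_ℝ ≤ 0}
      rw [hinter]
      refine isClosed_biInter fun l _ => isClosed_le (by fun_prop) continuous_const
    -- The pairings with the active normals form an injective linear map, which is antilipschitz; on
    -- `K` they all lie in `[-1, 0]`, so `K` is bounded.
    let f : EuclideanSpace ℝ (Fin n) →ₗ[ℝ] (hBfin.toFinset → ℝ) :=
      LinearMap.pi fun l => (innerSL ℝ (intVec l.1)).toLinearMap
    have hf : ∀ x l, f x l = ⟪x, intVec l.1⟫_ℝ := fun x l => by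
      simp [f, real_inner_comm]
    obtain ⟨c, -, hc⟩ := f.exists_antilipschitzWith (LinearMap.ker_eq_bot'.mpr fun x hx => by
      refine hB0 x fun l hl => ?_
      rw [← hf x ⟨l, hBfin.mem_toFinset.mpr hl⟩, hx]
      rfl)
    refine Metric.isCompact_of_isClosed_isBounded hcl
      ((hc.isBounded_preimage (Metric.isBounded_closedBall (x := 0) (r := 1))).subset ?_)
    rintro x ⟨hx1, hx2⟩
    rw [Set.mem_preimage, mem_closedBall_zero_iff, pi_norm_le_iff_of_nonneg zero_le_one]
    intro l
    have hl := hx1 l.1 (hBfin.mem_toFinset.mp l.2)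
    rw [hf, Real.norm_eq_abs, abs_of_nonpos hl, ← hx2, hφ]
    exact Finset.single_le_sum (f := fun l => -⟪x, intVec l⟫_ℝ)
      (fun m hm => neg_nonneg.mpr (hx1 m (hBfin.mem_toFinset.mp hm))) l.2
  have hφd : 0 < φ d := by
    have h0 : ∀ l ∈ hBfin.toFinset, 0 ≤ -⟪d, intVec l⟫_ℝ := fun l hl => by
      have := hBfin.mem_toFinset.mp hl
      exact neg_nonneg.mpr (hd l this.1 this.2)
    rw [hφ]
    refine lt_of_le_of_ne (Finset.sum_nonneg h0) fun h1 => ?_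
    have h2 := (Finset.sum_eq_zero_iff_of_nonneg h0).mp h1.symm
    have h3 := hB0 d fun l hl => neg_eq_zero.mp (h2 l (hBfin.mem_toFinset.mpr hl))
    rw [h3, inner_zero_left] at hda
    exact hda.false
  have hdK : (φ d)⁻¹ • d ∈ K := by
    refine ⟨fun l hl => ?_, by rw [map_smul, smul_eq_mul, inv_mul_cancel₀ hφd.ne']⟩
    rw [real_inner_smul_left]
    exact mul_nonpos_of_nonneg_of_nonpos (inv_pos.mpr hφd).le (hd l hl.1 hl.2)
  -- An extreme point `x` of the part of `K` where `a` is maximal is extreme in `K` and still pairs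
  -- positively with `a`. It will span the direction of an edge, contrary to `ha`.
  have hexp : IsExposed ℝ K ((innerSL ℝ a).toExposed K) :=
    ContinuousLinearMap.toExposed.isExposed
  obtain ⟨z, hzK, hz⟩ := hK.exists_isMaxOn ⟨_, hdK⟩ (innerSL ℝ a).continuous.continuousOn
  obtain ⟨x, hx⟩ := (hexp.isCompact hK).extremePoints_nonempty ⟨z, hzK, hz⟩
  have hxK := hexp.isExtreme.extremePoints_subset_extremePoints hx
  have hxa : 0 < ⟪x, a⟫_ℝ := by
    have h1 := hx.1.2 _ hdK
    simp only [innerSL_apply_apply, inner_smul_right] at h1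
    rw [real_inner_comm]
    refine lt_of_lt_of_le ?_ h1
    rw [real_inner_comm]
    exact mul_pos (inv_pos.mpr hφd) hda
  set A := {l ∈ B | ⟪x, intVec l⟫_ℝ = 0}
  have hAfin : A.Finite := hBfin.subset (Set.sep_subset _ _)
  have hx0 : x ≠ 0 := by
    rintro rfl
    simp at hxa
  -- Extremality of `x` in the slice means that the normals tight along `x` have only the line `ℝ x`
  -- as common kernel. Hence they cut out a one-dimensional face of `Δ` at `v`.
  have hker : ∀ u : EuclideanSpace ℝ (Fin n), (∀ l ∈ A, ⟪u, intVec l⟫_ℝ = 0) → u = φ u • x := by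
    intro u hu
    refine sub_eq_zero.mp ?_
    have hu' : ∀ l ∈ B, ⟪x, intVec l⟫_ℝ = 0 → ⟪u - φ u • x, intVec l⟫_ℝ = 0 := fun l hl h1 => by
      rw [inner_sub_left, real_inner_smul_left, hu l ⟨hl, h1⟩, h1, mul_zero, sub_zero]
    have hφu : φ (u - φ u • x) = 0 := by
      rw [map_sub, map_smul, hxK.1.2, smul_eq_mul, mul_one, sub_self]
    have e1 := eventually_inner_le hBfin hxK.1.1 fun l hl h1 => (hu' l hl h1).le
    have e2 := eventually_inner_le hBfin hxK.1.1 (u := -(u - φ u • x)) fun l hl h1 => by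
      rw [inner_neg_left, hu' l hl h1, neg_zero]
    obtain ⟨ε, ⟨h1, h2⟩, hε⟩ := ((e1.and e2).and self_mem_nhdsWithin).exists
    refine eq_zero_of_mem_extremePoints hxK hε ⟨h1, ?_⟩ ⟨h2, ?_⟩
    · rw [map_add, map_smul, hφu, hxK.1.2, smul_zero, add_zero]
    · rw [map_add, map_smul, map_neg, hφu, hxK.1.2, neg_zero, smul_zero, add_zero]
  obtain ⟨ε, h1, hε⟩ := ((eventually_inner_le h.finite_facetNormals (h.mem_iff.mp hv.mem)
    (u := x) fun l hl h1 => hxK.1.1 l ⟨hl, h1⟩).and self_mem_nhdsWithin).exists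
  have hε : 0 < ε := hε
  set e := {y ∈ Δ | ∀ l ∈ A, ⟪y, intVec l⟫_ℝ = 1}
  have hve : v ∈ e := ⟨hv.mem, fun l hl => hl.1.2⟩
  have hxe : v + ε • x ∈ e := ⟨h.mem_iff.mpr h1, fun l hl => by
    rw [inner_add_left, real_inner_smul_left, hl.1.2, hl.2, mul_zero, add_zero]⟩
  have hspan : vectorSpan ℝ e = Submodule.span ℝ {x} := by
    rw [vectorSpan_eq_span_vsub_set_right ℝ hve]
    apply le_antisymm
    · rw [Submodule.span_le]
      rintro _ ⟨y, hy, rfl⟩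
      rw [SetLike.mem_coe, Submodule.mem_span_singleton]
      refine ⟨φ (y - v), (hker _ fun l hl => ?_).symm⟩
      rw [inner_sub_left, hy.2 l hl, hve.2 l hl, sub_self]
    · rw [Submodule.span_singleton_le_iff_mem]
      have h2 : ε • x ∈ Submodule.span ℝ ((fun y => y -ᵥ v) '' e) :=
        Submodule.subset_span ⟨_, hxe, by simp⟩
      have h3 := Submodule.smul_mem _ ε⁻¹ h2
      rwa [smul_smul, inv_mul_cancel₀ hε.ne', one_smul] at h3
  have hedge : e ∈ edgesAt Δ v := by
    refine ⟨⟨⟨v, hve⟩, ?_, ?_⟩, hve⟩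
    · exact isExposed_inner_eq hAfin (fun y hy l hl => h.mem_iff.mp hy l hl.1.1) hv.mem hve.2
    · rw [affDim, hspan, finrank_span_singleton hx0]
  have h2 := ha e hedge _ hxe
  rw [add_sub_cancel_left, real_inner_smul_left] at h2
  exact h2.not_gt (mul_pos hε hxa)

end IsReflexive

end LatticePolytope

/-! ### Edges and the local model at a vertex. -/

namespace LatticePolytope

variable {n : ℕ} {Δ : Set (EuclideanSpace ℝ (Fin n))}

theorem finrank_pos_ne {F : Set (EuclideanSpace ℝ (Fin n))} (hF : affDim F = 1)
    (v : EuclideanSpace ℝ (Fin n)) : ∃ x ∈ F, x ≠ v := by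
  by_contra! hcon
  have h1 : vectorSpan ℝ F = ⊥ := by
    rw [vectorSpan_eq_bot_iff_subsingleton]
    exact fun x hx y hy => (hcon x hx).trans (hcon y hy).symm
  rw [affDim, h1, finrank_bot] at hF
  exact zero_ne_one hF

/-- An edge that lies on a half-line from one of its vertices is a segment between two vertices. -/
theorem IsReflexive.edge_eq_segment (h : IsReflexive Δ) {v : EuclideanSpace ℝ (Fin n)}
    {e : Set (EuclideanSpace ℝ (Fin n))} (he : e ∈ edgesAt Δ v) {w : Fin n → ℤ}
    (hw : e ⊆ ray v w) :
    ∃ T : ℝ, 0 < T ∧ e = segment ℝ v (v + T • intVec w) ∧ IsVertex Δ (v + T • intVec w) := by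
  have hexp : IsExposed ℝ Δ e := he.1.2.1
  have hcomp : IsCompact e := hexp.isCompact h.isPolytope.isCompact
  obtain ⟨x, hx, hxv⟩ := finrank_pos_ne he.1.2.2 v
  obtain ⟨t, ht, rfl⟩ := hw hx
  have ht0 : 0 < t := lt_of_le_of_ne ht (by rintro rfl; simp at hxv)
  have hw0 : 0 < ⟪intVec w, intVec w⟫_ℝ := by
    rw [real_inner_self_eq_norm_sq]
    have : intVec w ≠ 0 := by
      intro h0
      simp [h0] at hxv
    positivity
  -- The far end of the edge is its point furthest in the direction `w`.
  obtain ⟨q, hq, hmax⟩ := hcomp.exists_isMaxOn ⟨v, he.2⟩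
    (innerSL ℝ (intVec w)).continuous.continuousOn
  obtain ⟨T, hT, rfl⟩ := hw hq
  have hle : ∀ s : ℝ, v + s • intVec w ∈ e → s ≤ T := by
    intro s hs
    have h1 : innerSL ℝ (intVec w) (v + s • intVec w) ≤ innerSL ℝ (intVec w) (v + T • intVec w) :=
      hmax hs
    simp only [innerSL_apply_apply, inner_add_right, inner_smul_right, add_le_add_iff_left] at h1
    exact le_of_mul_le_mul_right h1 hw0
  have hT0 : 0 < T := ht0.trans_le (hle t hx)
  refine ⟨T, hT0, ?_, ?_⟩
  · apply Set.Subset.antisymm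
    · intro y hy
      obtain ⟨s, hs, rfl⟩ := hw hy
      rw [segment_eq_image']
      refine ⟨s / T, ⟨by positivity, (div_le_one hT0).mpr (hle s hy)⟩, ?_⟩
      simp only [add_sub_cancel_left, smul_smul]
      rw [div_mul_cancel₀ _ hT0.ne']
    · exact (hexp.convex h.isPolytope.convex).segment_subset he.2 hq
  · rw [h.isVertex_iff]
    refine hexp.isExtreme.extremePoints_subset_extremePoints ?_
    have h1 : IsExposed ℝ e {v + T • intVec w} := by
      intro _
      refine ⟨innerSL ℝ (intVec w), ?_⟩
      ext y
      simp only [Set.mem_singleton_iff, Set.mem_ofPred_eq]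
      constructor
      · rintro rfl
        exact ⟨hq, fun y hy => hmax hy⟩
      · rintro ⟨hy, hy2⟩
        obtain ⟨s, hs, rfl⟩ := hw hy
        have h2 := hy2 _ hq
        simp only [innerSL_apply_apply, inner_add_right, inner_smul_right,
          add_le_add_iff_left] at h2
        rw [le_antisymm (hle s hy) (le_of_mul_le_mul_right h2 hw0)]
    exact isExtreme_singleton.mp h1.isExtreme

theorem IsVertex.eq_or_eq_of_mem_segment {a b v : EuclideanSpace ℝ (Fin n)} (hv : IsVertex Δ v)
    (ha : a ∈ Δ) (hb : b ∈ Δ) (h : v ∈ segment ℝ a b) : v = a ∨ v = b :=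
  ((mem_extremePoints_iff_forall_segment.mp hv.mem_extremePoints).2 a ha b hb h).imp
    Eq.symm Eq.symm

theorem IsReflexive.exists_vertex_mem_edge (h : IsReflexive Δ)
    {e : Set (EuclideanSpace ℝ (Fin n))} (he : e ∈ faces Δ 1) :
    ∃ v, IsVertex Δ v ∧ e ∈ edgesAt Δ v := by
  obtain ⟨v, hv⟩ := (he.2.1.isCompact h.isPolytope.isCompact).extremePoints_nonempty he.1
  exact ⟨v, h.isVertex_iff.mpr (he.2.1.isExtreme.extremePoints_subset_extremePoints hv), he, hv.1⟩

/-- The local structure of a Delzant reflexive polytope at a vertex. -/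
structure IsLocalModel (Δ : Set (EuclideanSpace ℝ (Fin n))) (v : EuclideanSpace ℝ (Fin n))
    (E : Fin n → Set (EuclideanSpace ℝ (Fin n))) (w l : Fin n → (Fin n → ℤ)) : Prop where
  injective : Function.Injective E
  range_eq : Set.range E = edgesAt Δ v
  subset_ray : ∀ i, E i ⊆ ray v (w i)
  dual : ∀ i j, w i ⬝ᵥ l j = if i = j then -1 else 0
  mem : ∀ i, l i ∈ facetNormals Δ
  inner_eq_one : ∀ i, ⟪v, intVec (l i)⟫_ℝ = 1
  eq_of_inner_eq_one : ∀ a ∈ facetNormals Δ, ⟪v, intVec a⟫_ℝ = 1 → ∃ i, l i = a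

theorem exists_dual_basis {w : Fin n → (Fin n → ℤ)} (hw : LinearIndependent ℤ w)
    (hs : Submodule.span ℤ (Set.range w) = ⊤) :
    ∃ l : Fin n → (Fin n → ℤ), ∀ i j, w i ⬝ᵥ l j = if i = j then -1 else 0 := by
  let b := Module.Basis.mk hw hs.ge
  -- The sign makes the normals outward, as the edge directions point into `Δ`.
  refine ⟨fun j k => -b.coord j (Pi.single k 1), fun i j => ?_⟩
  have h1 : ∀ x : Fin n → ℤ, b.coord j x = ∑ k, x k * b.coord j (Pi.single k 1) := fun x => by
    conv_lhs => rw [pi_eq_sum_univ' x]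
    rw [map_sum]
    refine Finset.sum_congr rfl fun k _ => ?_
    rw [map_smul, smul_eq_mul]
  have h2 : b.coord j (w i) = if i = j then 1 else 0 := by
    have : w i = b i := by simp [b]
    rw [this, Module.Basis.coord_apply, Module.Basis.repr_self, Finsupp.single_apply]
  simp only [dotProduct, mul_neg, Finset.sum_neg_distrib]
  rw [← h1, h2]
  split_ifs <;> simp

/-- The dual basis `l` of the edge directions is integral because the latter form a basis of `ℤⁿ`.
What has to be shown is that its members are precisely the facet normals active at `v`. -/
theorem IsReflexive.exists_localModel (h : IsReflexive Δ) (hD : IsDelzant Δ)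
    {v : EuclideanSpace ℝ (Fin n)} (hv : IsVertex Δ v) : ∃ E w l, IsLocalModel Δ v E w l := by
  obtain ⟨hfin, hcard⟩ := hD.simple v hv
  obtain ⟨w', hw', hli, hspan⟩ := hD.smooth v hv
  have : Finite (edgesAt Δ v) := hfin
  let σ : Fin n ≃ edgesAt Δ v := (Finite.equivFinOfCardEq
    ((Nat.card_coe_set_eq _).trans hcard)).symm
  have hrange : Set.range (w' ∘ σ) = Set.range w' := σ.surjective.range_comp w'
  obtain ⟨l, hl⟩ := exists_dual_basis (hli.comp σ σ.injective) (by rw [hrange, hspan])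
  set w := w' ∘ σ
  have hray : ∀ i, (σ i : Set (EuclideanSpace ℝ (Fin n))) ⊆ ray v (w i) := fun i => hw' (σ i)
  have hdual : ∀ i j, ⟪intVec (w i), intVec (l j)⟫_ℝ = if i = j then -1 else 0 := fun i j => by
    rw [inner_intVec_intVec, hl]
    split_ifs <;> simp
  -- Each `l i` is nonpositive along every edge at `v`, hence on the whole tangent cone.
  have hcone : ∀ d : EuclideanSpace ℝ (Fin n),
      (∀ a ∈ facetNormals Δ, ⟪v, intVec a⟫_ℝ = 1 → ⟪d, intVec a⟫_ℝ ≤ 0) →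
      ∀ i, ⟪d, intVec (l i)⟫_ℝ ≤ 0 := by
    intro d hd i
    refine h.inner_nonpos_of_edges hv (fun e he x hx => ?_) hd
    obtain ⟨j, hj⟩ := σ.surjective ⟨e, he⟩
    have hxe : x ∈ (σ j : Set (EuclideanSpace ℝ (Fin n))) := by rw [hj]; exact hx
    obtain ⟨t, ht, rfl⟩ := hray j hxe
    rw [add_sub_cancel_left, real_inner_smul_left, hdual]
    split_ifs
    · linarith
    · simp
  have hw_tangent : ∀ a ∈ facetNormals Δ, ⟪v, intVec a⟫_ℝ = 1 →
      ∀ i, ⟪intVec (w i), intVec a⟫_ℝ ≤ 0 := by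
    intro a ha hva i
    obtain ⟨T, hT, he, hq⟩ := h.edge_eq_segment (σ i).2 (hray i)
    have h1 := h.mem_iff.mp hq.mem a ha
    rw [inner_add_left, real_inner_smul_left, hva] at h1
    by_contra! hcon
    have := mul_pos hT hcon
    linarith
  have hactive : ∀ a ∈ facetNormals Δ, ⟪v, intVec a⟫_ℝ = 1 → ∃ i, l i = a := by
    intro a ha hva
    obtain ⟨hprim, m, hm, F, hF, hFeq⟩ := ha
    have ha : a ∈ facetNormals Δ := ⟨hprim, m, hm, F, hF, hFeq⟩
    have hm1 : m = 1 := by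
      apply le_antisymm
      · obtain ⟨x, hx⟩ := hF.1
        have hx' := hx
        rw [hFeq] at hx'
        rw [← hx'.2]
        exact h.mem_iff.mp hx'.1 a ha
      · rw [← hva]
        exact hm v hv.mem
    subst hm1
    have hvF : v ∈ F := by rw [hFeq]; exact ⟨hv.mem, hva⟩
    -- The facet lies in the span of the edge directions orthogonal to `a`: in the expansion of `x -
    -- v` all terms pair with `a` in the same sign and add up to zero. Its dimension then forces all
    -- directions but one to be orthogonal to `a`, so `a` is a multiple of a single `l j`.
    let I : Finset (Fin n) := Finset.univ.filter fun i => w i ⬝ᵥ a = 0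
    have hsub : vectorSpan ℝ F ≤ Submodule.span ℝ
        (I.image fun i => intVec (w i) : Finset (EuclideanSpace ℝ (Fin n))) := by
      rw [vectorSpan_eq_span_vsub_set_right ℝ hvF, Submodule.span_le]
      rintro _ ⟨x, hx, rfl⟩
      rw [hFeq] at hx
      simp only [vsub_eq_sub]
      have h1 : ∀ i, ⟪x - v, intVec (l i)⟫_ℝ ≤ 0 := hcone _ fun b hb hvb => by
        rw [inner_sub_left, hvb]
        linarith [h.mem_iff.mp hx.1 b hb]
      have h2 : ∑ i, (-⟪x - v, intVec (l i)⟫_ℝ) * ⟪intVec (w i), intVec a⟫_ℝ = 0 := by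
        have h3 : ⟪x - v, intVec a⟫_ℝ = 0 := by rw [inner_sub_left, hx.2, hva, sub_self]
        conv_lhs at h3 => rw [eq_sum_inner hl (x - v), sum_inner]
        simpa only [real_inner_smul_left] using h3
      have h4 := (Finset.sum_eq_zero_iff_of_nonpos fun i _ =>
        mul_nonpos_of_nonneg_of_nonpos (neg_nonneg.mpr (h1 i)) (hw_tangent a ha hva i)).mp h2
      rw [SetLike.mem_coe, eq_sum_inner hl (x - v)]
      refine Submodule.sum_mem _ fun i hi => ?_
      rcases mul_eq_zero.mp (h4 i hi) with h5 | h5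
      · rw [h5, zero_smul]
        exact Submodule.zero_mem _
      · refine Submodule.smul_mem _ _ (Submodule.subset_span ?_)
        rw [inner_intVec_intVec] at h5
        rw [Finset.mem_coe]
        exact Finset.mem_image_of_mem _ (Finset.mem_filter.mpr
          ⟨Finset.mem_univ i, by exact_mod_cast h5⟩)
    have hdim : n - 1 ≤ I.card := by
      have h1 := Submodule.finrank_mono hsub
      have h2 := (finrank_span_finset_le_card (R := ℝ)
        (I.image fun i => intVec (w i))).trans Finset.card_image_le
      have h3 : Module.finrank ℝ (vectorSpan ℝ F) = n - 1 := hF.2.2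
      rw [← h3]
      exact h1.trans h2
    have ha0 : ∃ j, w j ⬝ᵥ a ≠ 0 := by
      by_contra! hcon
      have h1 : a = 0 := by
        rw [eq_sum_dual hl a]
        simp [hcon]
      have h2 := hprim 0 0 (by simp [h1])
      omega
    obtain ⟨j, hj⟩ := ha0
    have hI : I = Finset.univ.erase j := by
      refine Finset.eq_of_subset_of_card_le (fun i hi => ?_) ?_
      · refine Finset.mem_erase.mpr ⟨?_, Finset.mem_univ i⟩
        rintro rfl
        exact hj (Finset.mem_filter.mp hi).2
      · rw [Finset.card_erase_of_mem (Finset.mem_univ j), Finset.card_univ, Fintype.card_fin]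
        exact hdim
    have h1 : a = (-(w j ⬝ᵥ a)) • l j := by
      conv_lhs => rw [eq_sum_dual hl a]
      refine Finset.sum_eq_single j (fun i _ hij => ?_) (by simp)
      have : i ∈ I := by rw [hI]; exact Finset.mem_erase.mpr ⟨hij, Finset.mem_univ i⟩
      rw [(Finset.mem_filter.mp this).2, neg_zero, zero_smul]
    have h2 : w j ⬝ᵥ a ≤ 0 := by
      have := hw_tangent a ha hva j
      rw [inner_intVec_intVec] at this
      exact_mod_cast this
    refine ⟨j, ?_⟩
    -- Primitivity makes the factor `±1`, and `h2` excludes `-1`.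
    rcases hprim _ _ h1 with h3 | h3
    · rw [h3, one_smul] at h1
      exact h1.symm
    · omega
  have hconv : ∀ i, l i ∈ facetNormals Δ ∧ ⟪v, intVec (l i)⟫_ℝ = 1 := by
    intro i
    by_contra hcon
    -- If `l i` were not an active normal, all active normals would be among the other `l j`, which
    -- vanish on `w i`. Then `-w i` would lie in the tangent cone although it pairs to 1 with `l i`.
    have h1 := hcone (-intVec (w i)) (fun a ha hva => ?_) i
    · rw [inner_neg_left, hdual, if_pos rfl] at h1
      linarith
    · obtain ⟨j, rfl⟩ := hactive a ha hva
      have hij : i ≠ j := fun hij => hcon (hij ▸ ⟨ha, hva⟩)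
      rw [inner_neg_left, hdual, if_neg hij, neg_zero]
  refine ⟨fun i => σ i, w, l, fun i j hij => σ.injective (Subtype.ext hij), ?_, hray, hl,
    fun i => (hconv i).1, fun i => (hconv i).2, hactive⟩
  ext e
  constructor
  · rintro ⟨i, rfl⟩
    exact (σ i).2
  · intro he
    exact ⟨σ.symm ⟨e, he⟩, by simp⟩

/-- Every facet through `v` is at height 1, so all coordinates of `v` in the basis `w` equal `-1`.
-/
theorem IsLocalModel.intVec_position {v : EuclideanSpace ℝ (Fin n)}
    {E : Fin n → Set (EuclideanSpace ℝ (Fin n))} {w l : Fin n → (Fin n → ℤ)}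
    (h : IsLocalModel Δ v E w l) : intVec (-∑ i, w i) = v := by
  conv_rhs => rw [eq_sum_inner h.dual v]
  simp [h.inner_eq_one, intVec_neg, intVec_sum]

/-! ### Edge lengths as sums of ratios. -/

variable {ι : Type*} {P : ι → EuclideanSpace ℝ (Fin n)}
  {E : ι → Fin n → Set (EuclideanSpace ℝ (Fin n))} {w l : ι → Fin n → (Fin n → ℤ)}

theorem IsLocalModel.mem_edgesAt (hm : ∀ p, IsLocalModel Δ (P p) (E p) (w p) (l p)) (p : ι)
    (i : Fin n) : E p i ∈ edgesAt Δ (P p) := (hm p).range_eq ▸ ⟨i, rfl⟩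

/-- The edge `E p i` joins `p` to another vertex `q`, at which it is the edge `E q j` with the
opposite direction. -/
theorem IsReflexive.exists_opposite (h : IsReflexive Δ) (hP : ∀ v, IsVertex Δ v ↔ ∃ p, P p = v)
    (hm : ∀ p, IsLocalModel Δ (P p) (E p) (w p) (l p)) (p : ι) (i : Fin n) :
    ∃ q j, ∃ T : ℝ, 0 < T ∧ P q = P p + T • intVec (w p i) ∧ E p i = segment ℝ (P p) (P q) ∧
      E q j = E p i ∧ w q j = -w p i := by
  have he := IsLocalModel.mem_edgesAt hm p i
  obtain ⟨T, hT, hseg, hq⟩ := h.edge_eq_segment he ((hm p).subset_ray i)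
  obtain ⟨q, hq'⟩ := (hP _).mp hq
  rw [← hq'] at hseg
  have heq : E p i ∈ edgesAt Δ (P q) := ⟨he.1, hseg ▸ right_mem_segment ℝ _ _⟩
  obtain ⟨j, hj⟩ : E p i ∈ Set.range (E q) := (hm q).range_eq ▸ heq
  obtain ⟨T', hT', hseg', hp⟩ := h.edge_eq_segment heq (hj ▸ (hm q).subset_ray j)
  have hprim : ∀ p i, IsPrimitiveVec (w p i) := fun p i =>
    isPrimitiveVec_of_dotProduct (l := l p i) (by rw [(hm p).dual, if_pos rfl])
  have hr : HasRelativeLength (E p i) T :=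
    ⟨_, _, w p i, hseg, hprim p i, hT, by rw [hq', add_sub_cancel_left]⟩
  have hr' : HasRelativeLength (E p i) T' :=
    ⟨_, _, w q j, hseg', hprim q j, hT', by rw [add_sub_cancel_left]⟩
  -- Both directions are primitive, so the parameters measured from either end equal the relative
  -- length.
  have hTT := hr.unique hr'
  subst hTT
  have hw0 : ∀ p i, intVec (w p i) ≠ 0 := by
    intro p i h0
    have := inner_intVec_intVec (w p i) (l p i)
    rw [h0, (hm p).dual, if_pos rfl, inner_zero_left] at this
    norm_num at this
  have hmem : P q + T • intVec (w q j) ∈ segment ℝ (P p) (P q) := by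
    rw [← hseg, hseg']
    exact right_mem_segment ℝ _ _
  have hpV : IsVertex Δ (P p) := (hP _).mpr ⟨p, rfl⟩
  have hqV : IsVertex Δ (P q) := (hP _).mpr ⟨q, rfl⟩
  refine ⟨q, j, T, hT, hq', hseg, hj, ?_⟩
  rcases hp.eq_or_eq_of_mem_segment hpV.mem hqV.mem hmem with h1 | h1
  · apply intVec_injective
    rw [hq'] at h1
    have h2 : T • (intVec (w p i) + intVec (w q j)) = 0 := by
      rw [smul_add, ← add_right_inj (P p), ← add_assoc, h1, add_zero]
    rw [intVec_neg]
    exact eq_neg_of_add_eq_zero_right ((smul_eq_zero.mp h2).resolve_left hT.ne')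
  · rw [add_eq_left, smul_eq_zero] at h1
    exact absurd (h1.resolve_left hT.ne') (hw0 q j)

theorem IsReflexive.isSmoothReflexive (h : IsReflexive Δ) (hinj : Function.Injective P)
    (hP : ∀ v, IsVertex Δ v ↔ ∃ p, P p = v)
    (hm : ∀ p, IsLocalModel Δ (P p) (E p) (w p) (l p)) : IsSmoothReflexive w l := by
  have hpos : ∀ p, intVec (-∑ i, w p i) = P p := fun p => (hm p).intVec_position
  have hinner : ∀ q a, (((-∑ i, w q i) ⬝ᵥ a : ℤ) : ℝ) = ⟪P q, intVec a⟫_ℝ := fun q a => by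
    rw [← hpos q, inner_intVec_intVec]
  refine ⟨fun p => (hm p).dual, fun p q i => ?_, fun p q i h1 => ?_, fun p q h1 => ?_,
    fun p i => ?_⟩
  · have h1 := h.mem_iff.mp ((hP (P q)).mpr ⟨q, rfl⟩).mem _ ((hm p).mem i)
    rw [← hinner] at h1
    exact_mod_cast h1
  · refine (hm q).eq_of_inner_eq_one _ ((hm p).mem i) ?_
    rw [← hinner, h1, Int.cast_one]
  · refine hinj ?_
    rw [← hpos p, ← hpos q]
    exact congrArg intVec h1
  · obtain ⟨q, j, T, hT, hq, -⟩ := h.exists_opposite hP hm p i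
    -- Pairing `P q = P p + T • intVec (w p i)` with `l p i` gives `1 - T`, so `T` is an integer.
    have h1 : T = ((1 - (-∑ i, w q i) ⬝ᵥ l p i : ℤ) : ℝ) := by
      push_cast
      have h2 := hinner q (l p i)
      rw [hq, inner_add_left, real_inner_smul_left, (hm p).inner_eq_one, inner_intVec_intVec,
        (hm p).dual, if_pos rfl] at h2
      push_cast at h2
      linarith
    refine ⟨q, 1 - (-∑ i, w q i) ⬝ᵥ l p i, ?_, intVec_injective ?_⟩
    · rw [h1] at hT
      exact_mod_cast hT
    · rw [intVec_add, intVec_zsmul, ← h1, hpos, hpos, hq]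

/-- The sum of the relative lengths of the edges, as a sum over the pairs of a vertex and an edge
at this vertex. -/
theorem IsReflexive.sum_relativeLength [Fintype ι] (h : IsReflexive Δ)
    (hinj : Function.Injective P) (hP : ∀ v, IsVertex Δ v ↔ ∃ p, P p = v)
    (hm : ∀ p, IsLocalModel Δ (P p) (E p) (w p) (l p)) {ξ : (Fin n → ℤ) →+ ℝ}
    (hξ : ∀ p i, ξ (w p i) ≠ 0) :
    (faces Δ 1).Finite ∧ (∀ e ∈ faces Δ 1, HasRelativeLength e (relativeLength e)) ∧
      ∑ᶠ e ∈ faces Δ 1, relativeLength e = ∑ p, ∑ i, ∑ j, ξ (w p j) / ξ (w p i) := by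
  classical
  have hfaces : faces Δ 1 = ((Finset.univ : Finset (ι × Fin n)).image fun a => E a.1 a.2 :
      Finset (Set (EuclideanSpace ℝ (Fin n)))) := by
    ext e
    simp only [Finset.coe_image, Finset.coe_univ, Set.image_univ, Set.mem_range, Prod.exists]
    constructor
    · intro he
      obtain ⟨v, hv, hev⟩ := h.exists_vertex_mem_edge he
      obtain ⟨p, rfl⟩ := (hP v).mp hv
      rw [← (hm p).range_eq] at hev
      exact ⟨p, hev⟩
    · rintro ⟨p, i, rfl⟩
      exact (IsLocalModel.mem_edgesAt hm p i).1
  have hprim : ∀ p i, IsPrimitiveVec (w p i) := fun p i =>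
    isPrimitiveVec_of_dotProduct (l := l p i) (by rw [(hm p).dual, if_pos rfl])
  refine ⟨hfaces ▸ Finset.finite_toSet _, fun e he => ?_, ?_⟩
  · obtain ⟨v, hv, hev⟩ := h.exists_vertex_mem_edge he
    obtain ⟨p, rfl⟩ := (hP v).mp hv
    obtain ⟨i, rfl⟩ : e ∈ Set.range (E p) := (hm p).range_eq ▸ hev
    obtain ⟨q, j, T, hT, hq, hseg, -, -⟩ := h.exists_opposite hP hm p i
    have hr : HasRelativeLength (E p i) T :=
      ⟨_, _, w p i, hseg, hprim p i, hT, by rw [hq, add_sub_cancel_left]⟩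
    rwa [hr.relativeLength_eq]
  · rw [hfaces, finsum_mem_coe_finset, ← Fintype.sum_prod_type'
      (f := fun p i => ∑ j, ξ (w p j) / ξ (w p i))]
    -- Each edge comes from exactly two pairs of a vertex and an index, one for each end. It remains
    -- to write its length as the sum of their two contributions.
    refine Finset.sum_image' _ fun a _ => ?_
    obtain ⟨p, i⟩ := a
    obtain ⟨q, j, T, hT, hq, hseg, hE, hw⟩ := h.exists_opposite hP hm p i
    have hr : HasRelativeLength (E p i) T :=
      ⟨_, _, w p i, hseg, hprim p i, hT, by rw [hq, add_sub_cancel_left]⟩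
    have hpV : IsVertex Δ (P p) := (hP _).mpr ⟨p, rfl⟩
    have hqV : IsVertex Δ (P q) := (hP _).mpr ⟨q, rfl⟩
    have hpq : (p, i) ≠ (q, j) := by
      intro hpq
      obtain ⟨rfl, rfl⟩ := Prod.mk.inj hpq
      have h1 := congrArg ξ hw
      rw [map_neg] at h1
      exact hξ p i (by linarith)
    have hfib : (Finset.univ.filter fun b : ι × Fin n => E b.1 b.2 = E p i) =
        {(p, i), (q, j)} := by
      ext ⟨r, k⟩
      simp only [Finset.mem_filter, Finset.mem_univ, true_and, Finset.mem_insert,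
        Finset.mem_singleton, Prod.mk.injEq]
      constructor
      · intro hrk
        have hrV : IsVertex Δ (P r) := (hP _).mpr ⟨r, rfl⟩
        have hmem : P r ∈ segment ℝ (P p) (P q) := by
          rw [← hseg, ← hrk]
          exact (IsLocalModel.mem_edgesAt hm r k).2
        rcases hrV.eq_or_eq_of_mem_segment hpV.mem hqV.mem hmem with h1 | h1
        · obtain rfl := hinj h1
          exact Or.inl ⟨rfl, (hm r).injective hrk⟩
        · obtain rfl := hinj h1
          exact Or.inr ⟨rfl, (hm r).injective (hrk.trans hE.symm)⟩
      · rintro (⟨rfl, rfl⟩ | ⟨rfl, rfl⟩)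
        · rfl
        · exact hE
    simp only
    rw [hr.relativeLength_eq, hfib, Finset.sum_pair hpq]
    -- `ξ` is only defined and additive on the lattice, so `T` has to be an integer before `ξ` can
    -- be applied to the difference of the ends.
    obtain ⟨t, ht⟩ : ∃ t : ℤ, T = t := by
      refine ⟨1 - (-∑ i, w q i) ⬝ᵥ l p i, ?_⟩
      have h2 := inner_intVec_intVec (-∑ i, w q i) (l p i)
      rw [(hm q).intVec_position, hq, inner_add_left, real_inner_smul_left,
        (hm p).inner_eq_one, inner_intVec_intVec, (hm p).dual, if_pos rfl] at h2
      push_cast at h2 ⊢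
      linarith
    have h1 : -∑ k, w q k = -∑ k, w p k + t • w p i := by
      apply intVec_injective
      rw [intVec_add, intVec_zsmul, ← ht, (hm q).intVec_position, (hm p).intVec_position, hq]
    have h2 := congrArg ξ h1
    rw [map_add, map_neg, map_neg, map_sum, map_sum, map_zsmul, zsmul_eq_mul, ← ht] at h2
    -- The direction at `q` is `-w p i`, so the two ratio sums combine to `(ξ q - ξ p) / ξ (w p i)`,
    -- where `p` and `q` stand for the positions.
    simp only [hw, map_neg, div_neg, Finset.sum_neg_distrib, ← Finset.sum_div]
    have h3 := hξ p i
    field_simp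
    linarith

theorem faces_zero_eq (Δ : Set (EuclideanSpace ℝ (Fin n))) :
    faces Δ 0 = (fun v => {v}) '' {v | IsVertex Δ v} := by
  ext F
  constructor
  · intro hF
    obtain ⟨v, hv⟩ := hF.1
    have h1 : vectorSpan ℝ F = ⊥ := Submodule.finrank_eq_zero.mp hF.2.2
    rw [vectorSpan_eq_bot_iff_subsingleton] at h1
    obtain rfl : F = {v} := h1.eq_singleton_of_mem hv
    exact ⟨v, hF, rfl⟩
  · rintro ⟨v, hv, rfl⟩
    exact hv

theorem IsReflexive.exists_data (h : IsReflexive Δ) (hD : IsDelzant Δ) (hn : n ≠ 0) :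
    ∃ (ι : Type) (_ : Fintype ι) (_ : Nonempty ι) (w l : ι → Fin n → (Fin n → ℤ))
      (ξ : (Fin n → ℤ) →+ ℝ), IsSmoothReflexive w l ∧ (∀ p i, ξ (w p i) ≠ 0) ∧
      (faces Δ 0).Finite ∧ (faces Δ 0).ncard = Fintype.card ι ∧ (faces Δ 1).Finite ∧
      (∀ e ∈ faces Δ 1, HasRelativeLength e (relativeLength e)) ∧
      ∑ᶠ e ∈ faces Δ 1, relativeLength e = ∑ p, ∑ i, ∑ j, ξ (w p j) / ξ (w p i) := by
  let ι := {v // IsVertex Δ v}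
  have : Finite ι := h.finite_vertices
  let hι : Fintype ι := Fintype.ofFinite ι
  have hne : Nonempty ι := let ⟨v, hv⟩ := h.exists_isVertex; ⟨⟨v, hv⟩⟩
  choose E w l hm using fun p : ι => h.exists_localModel hD p.2
  have hP : ∀ v, IsVertex Δ v ↔ ∃ p : ι, p.1 = v := fun v =>
    ⟨fun hv => ⟨⟨v, hv⟩, rfl⟩, by rintro ⟨p, rfl⟩; exact p.2⟩
  have hS := h.isSmoothReflexive Subtype.val_injective hP hm
  -- Any nonzero vector would do: `exists_generic` needs one, and its sign condition is discarded.
  have hx : (fun _ : Fin n => (1 : ℤ)) ≠ 0 := fun h0 => one_ne_zero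
    (congrFun h0 ⟨0, Nat.pos_of_ne_zero hn⟩)
  obtain ⟨ξ, hξ, -⟩ := hS.exists_generic _ hx
  refine ⟨ι, hι, hne, w, l, ξ, hS, hξ, ?_, ?_,
    h.sum_relativeLength Subtype.val_injective hP hm hξ⟩
  · rw [faces_zero_eq]
    exact h.finite_vertices.image _
  · rw [faces_zero_eq, Set.ncard_image_of_injective _ Set.singleton_injective,
      ← Nat.card_eq_fintype_card, ← Nat.card_coe_set_eq]
    rfl

end LatticePolytope

theorem corollary2p10 :
    (∀ Δ : Set (EuclideanSpace ℝ (Fin 2)),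
      LatticePolytope.IsDelzant Δ → LatticePolytope.IsReflexive Δ →
        (LatticePolytope.faces Δ 0).Finite ∧ (LatticePolytope.faces Δ 1).Finite ∧
        (∀ e ∈ LatticePolytope.faces Δ 1,
          LatticePolytope.HasRelativeLength e (LatticePolytope.relativeLength e)) ∧
        (∑ᶠ e ∈ LatticePolytope.faces Δ 1, LatticePolytope.relativeLength e)
          + ((LatticePolytope.faces Δ 0).ncard : ℝ) = 12) ∧
    (∀ Δ : Set (EuclideanSpace ℝ (Fin 3)),
      LatticePolytope.IsDelzant Δ → LatticePolytope.IsReflexive Δ →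
        (LatticePolytope.faces Δ 1).Finite ∧
        (∀ e ∈ LatticePolytope.faces Δ 1,
          LatticePolytope.HasRelativeLength e (LatticePolytope.relativeLength e)) ∧
        (∑ᶠ e ∈ LatticePolytope.faces Δ 1, LatticePolytope.relativeLength e) = 24) := by
  constructor
  · intro Δ hD hR
    obtain ⟨ι, _, _, w, l, ξ, hS, hξ, hfin, hcard, hfin1, hlen, hsum⟩ :=
      hR.exists_data hD two_ne_zero
    refine ⟨hfin, hfin1, hlen, ?_⟩
    rw [hsum, hcard]
    exact hS.sum_ratio_two hξ
  · intro Δ hD hR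
    obtain ⟨ι, _, _, w, l, ξ, hS, hξ, -, -, hfin1, hlen, hsum⟩ :=
      hR.exists_data hD three_ne_zero
    refine ⟨hfin1, hlen, ?_⟩
    rw [hsum]
    exact hS.sum_ratio_three hξ
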